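/- Let $d\ge 2$, let $G$ be a compact connected Abelian Lie group with Lie algebra $\mathfrak g$, fix an inner product on $\mathfrak g$, and let $\beta>0$. Consider the cubical cell structure of $\mathbb R^d$ with vertex set $\mathbb Z^d$, and let $\mathcal F$ be the set of its finite subcomplexes $K$ that are homeomorphic to a connected contractible $d$-dimensional manifold with boundary, ordered by inclusion. For $K\in\mathcal F$ let $C^k(K;G)$ and $C^k(K;\mathfrak g)$ be the cellular $k$-cochains, $d^{G}_{K,k}$ and $d^{\mathfrak g}_{K,k}$ the coboundary operators, and equip $\operatorname{Im} d^{\mathfrak g}_{K,1}$ with the restriction of the Euclidean inner product of $C^2(K;\mathfrak g)$. The space $\operatorname{Im} d^{\mathfrak g}_{K,1}$ is the Lie algebra of the compact connected Abelian Lie group $\operatorname{Im} d^{G}_{K,1}$; for a character $\chi$ of the latter let $J_K(\chi)\in(\operatorname{Im} d^{\mathfrak g}_{K,1})^*$ be given by $\chi(\exp v)=e^{2\pi i J_K(\chi)(v)}$. With respect to restriction of cochains, let $A=\varprojlim_{K\in\mathcal F} \operatorname{Im} d^{G}_{K,1}$ and $Q=\varprojlim_{K\in\mathcal F} C^1(K;G)/\operatorname{Im}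 d^{G}_{K,0}$ as compact groups, and let $\mathcal H$ be the projective limit of the Hilbert spaces $\operatorname{Im} d^{\mathfrak g}_{K,1}$ in the category of Hilbert spaces and linear contractions (the bounded compatible families with the supremum norm). Each character of $A$ has the form $\chi\circ\pi_K$ with $\chi$ a character of some $\operatorname{Im} d^{G}_{K,1}$ and $\pi_K$ the projection; set $J(\chi\circ\pi_K)=J_K(\chi)\circ\pi_K\in\mathcal H^*$. Let $\bar d: Q\to A$ be the map induced by the operators $d^{G}_{K,1}$. Then there is a unique Borel probability measure $\mu^H_\beta$ on $A$ with $$\int_A\overline{\chi}\,d\mu^H_\beta=\exp\bigl(-4\pi^2\beta\,\|J(\chi)\|_{\mathcal H^*}^2\bigr)\qquad\text{for all characters }\chi\text{ of }A,$$ the map $\bar d$ is a homeomorphism, and the modified Villain measure $$\mu_{\beta,\mathbb Z^d}:=(\bar d^{\,-1})_*\,\mu^H_\beta$$ on $Q$ is invariant under the action of $\mathbb Z^d$ on $Q$ by lattice translations. -/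

import Mathlib

open MeasureTheory
open scoped Manifold ContDiff ENNReal

noncomputable section

namespace Villain

/-! ### Projective limits and heat kernel measures -/

section Limits

variable {ι : Type*} [Preorder ι]

/-- The limit of a projective system of groups: the compatible families.  If the groups are
topological, it carries the topology induced by the product topology. -/
def projLimGroup (A : ι → Type*) [∀ i, Group (A i)] (Ψ : ∀ i j, i ≤ j → A j →* A i) :
    Subgroup (∀ i, A i) where
  carrier := {x | ∀ i j (h : i ≤ j), Ψ i j h (x j) = x i}
  mul_mem' := fun hx hy i j h => by simp [hx i j h, hy i j h]
  one_mem' := fun i j h => by simp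
  inv_mem' := fun hx i j h => by simp [hx i j h]

/-- The limit of a projective system of Hilbert spaces and linear contractions: the bounded
compatible families, with the norm `‖x‖ = ⨆ i, ‖x i‖`.  (Over a directed index set this norm is
the monotone limit of the norms `‖x i‖`, hence again comes from an inner product.) -/
def projLimHilb (V : ι → Type*) [∀ i, NormedAddCommGroup (V i)] [∀ i, InnerProductSpace ℝ (V i)]
    (Φ : ∀ i j, i ≤ j → V j →ₗ[ℝ] V i) : Submodule ℝ (lp V ∞) where
  carrier := {x | ∀ i j (h : i ≤ j), Φ i j h (x j) = x i}
  add_mem' := fun hx hy i j h => by simp [hx i j h, hy i j h]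
  zero_mem' := fun i j h => by simp
  smul_mem' := fun c x hx i j h => by simp [hx i j h]

instance (V : ι → Type*) [∀ i, NormedAddCommGroup (V i)] [∀ i, InnerProductSpace ℝ (V i)]
    (Φ : ∀ i j, i ≤ j → V j →ₗ[ℝ] V i) : NormedAddCommGroup (projLimHilb V Φ) :=
  Submodule.normedAddCommGroup _

instance (V : ι → Type*) [∀ i, NormedAddCommGroup (V i)] [∀ i, InnerProductSpace ℝ (V i)]
    (Φ : ∀ i j, i ≤ j → V j →ₗ[ℝ] V i) : NormedSpace ℝ (projLimHilb V Φ) :=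
  Submodule.normedSpace _

/-- The canonical projection from the limit Hilbert space. -/
def projLimHilb.proj (V : ι → Type*) [∀ i, NormedAddCommGroup (V i)]
    [∀ i, InnerProductSpace ℝ (V i)] (Φ : ∀ i j, i ≤ j → V j →ₗ[ℝ] V i) (i : ι) :
    projLimHilb V Φ →L[ℝ] V i :=
  (lp.evalCLM ℝ V ∞ i).comp (projLimHilb V Φ).subtypeL

/-- Every character of the limit group is of the form `χᵢ ∘ πᵢ` for a character `χᵢ` of some `A i`
(the dual of the limit is the direct limit of the duals); the limit of maps `J i` from the
characters of `A i` to the dual of `V i` sends it to `J i χᵢ ∘ πᵢ`. -/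
def IsLimJ (A : ι → Type*) [∀ i, CommGroup (A i)] [∀ i, TopologicalSpace (A i)]
    (Ψ : ∀ i j, i ≤ j → A j →* A i)
    (V : ι → Type*) [∀ i, NormedAddCommGroup (V i)] [∀ i, InnerProductSpace ℝ (V i)]
    (Φ : ∀ i j, i ≤ j → V j →ₗ[ℝ] V i)
    (J : ∀ i, PontryaginDual (A i) → (V i →L[ℝ] ℝ))
    (χ : PontryaginDual (projLimGroup A Ψ)) (ξ : projLimHilb V Φ →L[ℝ] ℝ) : Prop :=
  ∃ (i : ι) (χ' : PontryaginDual (A i)), (∀ x : projLimGroup A Ψ, χ x = χ' (x.1 i)) ∧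
    ξ = (J i χ').comp (projLimHilb.proj V Φ i)

open Classical in
/-- The map from the characters of the limit group to the dual of the limit Hilbert space. -/
def limJ (A : ι → Type*) [∀ i, CommGroup (A i)] [∀ i, TopologicalSpace (A i)]
    (Ψ : ∀ i j, i ≤ j → A j →* A i)
    (V : ι → Type*) [∀ i, NormedAddCommGroup (V i)] [∀ i, InnerProductSpace ℝ (V i)]
    (Φ : ∀ i j, i ≤ j → V j →ₗ[ℝ] V i)
    (J : ∀ i, PontryaginDual (A i) → (V i →L[ℝ] ℝ))
    (χ : PontryaginDual (projLimGroup A Ψ)) : projLimHilb V Φ →L[ℝ] ℝ :=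
  if h : ∃ ξ, IsLimJ A Ψ V Φ J χ ξ then h.choose else 0

/-- `μ` is a probability measure with Fourier transform `χ ↦ exp (-4π²β‖J χ‖²)`. -/
def IsHeatKernelMeasure {A : Type*} [CommGroup A] [TopologicalSpace A] [MeasurableSpace A]
    {V : Type*} [NormedAddCommGroup V] [NormedSpace ℝ V]
    (J : PontryaginDual A → (V →L[ℝ] ℝ)) (β : ℝ) (μ : Measure A) : Prop :=
  IsProbabilityMeasure μ ∧ ∀ χ : PontryaginDual A,
    ∫ x, (starRingEnd ℂ) (χ x : ℂ) ∂μ = (Real.exp (-4 * Real.pi ^ 2 * β * ‖J χ‖ ^ 2) : ℂ)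

open Classical in
/-- The heat kernel measure associated to `J`: the measure characterized by
`IsHeatKernelMeasure` (and `0` should there be none). -/
def heatKernelMeasure {A : Type*} [CommGroup A] [TopologicalSpace A] [MeasurableSpace A]
    {V : Type*} [NormedAddCommGroup V] [NormedSpace ℝ V]
    (J : PontryaginDual A → (V →L[ℝ] ℝ)) (β : ℝ) : Measure A :=
  if h : ∃ μ, IsHeatKernelMeasure J β μ then h.choose else 0

end Limits

/-! ### The cubical complex `ℤ^d` and its finite subcomplexes -/

/-- A cell of the cubical lattice `ℤ^d`: the cube with lowest vertex `c.1 ∈ ℤ^d` whose edge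
directions are the coordinate directions in `c.2`, so its dimension is `c.2.card`. -/
abbrev Cell (d : ℕ) : Type := (Fin d → ℤ) × Finset (Fin d)

/-- The face of `c` opposite to the one through `c.1`, in direction `i`. -/
def Cell.upper {d : ℕ} (c : Cell d) (i : Fin d) : Cell d :=
  (c.1 + Pi.single i 1, c.2.erase i)

/-- The face of `c` through its lowest vertex, orthogonal to direction `i`. -/
def Cell.lower {d : ℕ} (c : Cell d) (i : Fin d) : Cell d :=
  (c.1, c.2.erase i)

/-- The incidence number of `c` and its upper face in direction `i`, for the orientations of the
cells given by the order of the coordinates; the one for the lower face is its negative. -/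
def Cell.sign {d : ℕ} (c : Cell d) (i : Fin d) : ℤ :=
  (-1) ^ (c.2.filter (· < i)).card

/-- The translate of a cell by `a`. -/
def Cell.shift {d : ℕ} (a : Fin d → ℤ) (c : Cell d) : Cell d := (c.1 + a, c.2)

/-- The closed cube in `ℝ^d` represented by a cell. -/
def Cell.cube {d : ℕ} (c : Cell d) : Set (EuclideanSpace ℝ (Fin d)) :=
  {y | ∀ i, (c.1 i : ℝ) ≤ y i ∧ y i ≤ c.1 i + (if i ∈ c.2 then 1 else 0)}

/-- The union in `ℝ^d` of the closed cubes of a finite set of cells. -/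
def realization {d : ℕ} (K : Finset (Cell d)) : Set (EuclideanSpace ℝ (Fin d)) :=
  ⋃ c ∈ K, c.cube

/-- The index set of the projective systems: finite subcomplexes of `ℤ^d` that are
(connected and) contractible `d`-dimensional topological manifolds with boundary. -/
structure Region (d : ℕ) [NeZero d] where
  cells : Finset (Cell d)
  upper_mem : ∀ c ∈ cells, ∀ i ∈ c.2, c.upper i ∈ cells
  lower_mem : ∀ c ∈ cells, ∀ i ∈ c.2, c.lower i ∈ cells
  contractible : ContractibleSpace (realization cells)
  manifold : Nonempty (ChartedSpace (EuclideanHalfSpace d) (realization cells))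

instance (d : ℕ) [NeZero d] : Preorder (Region d) := Preorder.lift Region.cells

section Shift

variable {d : ℕ}

theorem Cell.shift_injective (a : Fin d → ℤ) : Function.Injective (Cell.shift a) := by
  rintro ⟨x, S⟩ ⟨y, T⟩ h
  simpa [Cell.shift] using h

theorem Cell.shift_upper (a : Fin d → ℤ) (c : Cell d) (i : Fin d) :
    (c.upper i).shift a = (c.shift a).upper i := by
  simp [Cell.shift, Cell.upper, add_right_comm]

theorem Cell.shift_lower (a : Fin d → ℤ) (c : Cell d) (i : Fin d) :
    (c.lower i).shift a = (c.shift a).lower i := rfl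

/-- The translate of a finite set of cells. -/
def shiftCells (a : Fin d → ℤ) (K : Finset (Cell d)) : Finset (Cell d) :=
  K.map ⟨Cell.shift a, Cell.shift_injective a⟩

theorem shift_mem_shiftCells (a : Fin d → ℤ) {K : Finset (Cell d)} {c : Cell d} (h : c ∈ K) :
    c.shift a ∈ shiftCells a K :=
  Finset.mem_map_of_mem _ h

theorem mem_cube_shift (a : Fin d → ℤ) (c : Cell d) (y : EuclideanSpace ℝ (Fin d)) :
    y + WithLp.toLp 2 (fun i => (a i : ℝ)) ∈ (c.shift a).cube ↔ y ∈ c.cube := by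
  refine forall_congr' fun i => ?_
  by_cases hi : i ∈ c.2 <;> simp only [Cell.shift, PiLp.add_apply, Pi.add_apply, Int.cast_add,
    hi, if_true, if_false] <;> constructor <;> rintro ⟨h1, h2⟩ <;> constructor <;> linarith

theorem mem_realization_shift (a : Fin d → ℤ) (K : Finset (Cell d))
    (y : EuclideanSpace ℝ (Fin d)) :
    y + WithLp.toLp 2 (fun i => (a i : ℝ)) ∈ realization (shiftCells a K) ↔
      y ∈ realization K := by
  simp only [realization, shiftCells, Set.mem_iUnion, Finset.mem_map, exists_prop]
  constructor
  · rintro ⟨_, ⟨c, hc, rfl⟩, h⟩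
    exact ⟨c, hc, (mem_cube_shift a c y).1 h⟩
  · rintro ⟨c, hc, h⟩
    exact ⟨_, ⟨c, hc, rfl⟩, (mem_cube_shift a c y).2 h⟩

/-- Translation as a homeomorphism of realizations. -/
def realizationShift (a : Fin d → ℤ) (K : Finset (Cell d)) :
    realization K ≃ₜ realization (shiftCells a K) :=
  (Homeomorph.addRight (WithLp.toLp 2 (fun i => (a i : ℝ)))).subtype
    fun y => (mem_realization_shift a K y).symm

theorem nonempty_chartedSpace_of_homeomorph {H X Y : Type*} [TopologicalSpace H]
    [TopologicalSpace X] [TopologicalSpace Y] (e : X ≃ₜ Y) (h : Nonempty (ChartedSpace H X)) :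
    Nonempty (ChartedSpace H Y) := by
  obtain ⟨h⟩ := h
  exact ⟨{ atlas := Set.univ
           chartAt := fun y => e.symm.toOpenPartialHomeomorph.trans (chartAt H (e.symm y))
           mem_chart_source := fun y => by simp
           chart_mem_atlas := fun y => Set.mem_univ _ }⟩

/-- The translate of a region. -/
def Region.shift [NeZero d] (a : Fin d → ℤ) (K : Region d) : Region d where
  cells := shiftCells a K.cells
  upper_mem := by
    intro c hc i hi
    obtain ⟨c', hc', rfl⟩ := Finset.mem_map.1 hc
    exact Cell.shift_upper a c' i ▸ shift_mem_shiftCells a (K.upper_mem c' hc' i hi)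
  lower_mem := by
    intro c hc i hi
    obtain ⟨c', hc', rfl⟩ := Finset.mem_map.1 hc
    exact Cell.shift_lower a c' i ▸ shift_mem_shiftCells a (K.lower_mem c' hc' i hi)
  contractible :=
    haveI := K.contractible
    (realizationShift a K.cells).symm.contractibleSpace
  manifold := nonempty_chartedSpace_of_homeomorph (realizationShift a K.cells) K.manifold

theorem Region.shift_mono [NeZero d] (a : Fin d → ℤ) {K K' : Region d} (h : K ≤ K') :
    K.shift a ≤ K'.shift a :=
  Finset.map_subset_map.2 h

end Shift

/-! ### Cochains and coboundary operators -/

section Cochains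

variable {d : ℕ} [NeZero d]

/-- The `k`-cells of `K`. -/
abbrev KCell (K : Region d) (k : ℕ) : Type := {c : Cell d // c ∈ K.cells.filter (·.2.card = k)}

variable {K : Region d} {k : ℕ}

/-- The upper face, as a cell of `K`. -/
def KCell.upper (c : KCell K (k + 1)) (i : c.1.2) : KCell K k :=
  ⟨c.1.upper i, by
    have h := Finset.mem_filter.1 c.2
    refine Finset.mem_filter.2 ⟨K.upper_mem _ h.1 _ i.2, ?_⟩
    simp [Cell.upper, Finset.card_erase_of_mem i.2, h.2]⟩

/-- The lower face, as a cell of `K`. -/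
def KCell.lower (c : KCell K (k + 1)) (i : c.1.2) : KCell K k :=
  ⟨c.1.lower i, by
    have h := Finset.mem_filter.1 c.2
    refine Finset.mem_filter.2 ⟨K.lower_mem _ h.1 _ i.2, ?_⟩
    simp [Cell.lower, Finset.card_erase_of_mem i.2, h.2]⟩

/-- The inclusion of the cells of a smaller region. -/
def KCell.incl {K K' : Region d} (h : K ≤ K') (c : KCell K k) : KCell K' k :=
  ⟨c.1, Finset.mem_filter.2 ⟨h (Finset.mem_filter.1 c.2).1, (Finset.mem_filter.1 c.2).2⟩⟩

/-- The translate of a cell of `K`, as a cell of the translate of `K`. -/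
def KCell.shift (a : Fin d → ℤ) (c : KCell K k) : KCell (K.shift a) k :=
  ⟨c.1.shift a, Finset.mem_filter.2
    ⟨shift_mem_shiftCells a (Finset.mem_filter.1 c.2).1, (Finset.mem_filter.1 c.2).2⟩⟩

/-- `k`-cochains on `K` with values in `A`. -/
abbrev Cochain (K : Region d) (k : ℕ) (A : Type*) : Type _ := KCell K k → A

/-- The coboundary operator on cochains with values in a multiplicative Abelian group. -/
def cobG (A : Type*) [CommGroup A] (K : Region d) (k : ℕ) :
    Cochain K k A →* Cochain K (k + 1) A where
  toFun f c := ∏ i : c.1.2, (f (c.upper i) / f (c.lower i)) ^ c.1.sign i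
  map_one' := by ext c; simp
  map_mul' f g := by
    ext c
    simp only [Pi.mul_apply, ← Finset.prod_mul_distrib, ← mul_zpow, mul_div_mul_comm]

/-- The coboundary operator on cochains with values in an inner product space; the target carries
the Euclidean (`ℓ²`) inner product. -/
def cobLie (𝔤 : Type*) [NormedAddCommGroup 𝔤] [InnerProductSpace ℝ 𝔤] (K : Region d) (k : ℕ) :
    Cochain K k 𝔤 →ₗ[ℝ] PiLp 2 (fun _ : KCell K (k + 1) => 𝔤) where
  toFun f := WithLp.toLp 2 fun c => ∑ i : c.1.2, c.1.sign i • (f (c.upper i) - f (c.lower i))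
  map_add' f g := by
    ext c
    simp only [PiLp.add_apply, Pi.add_apply, ← Finset.sum_add_distrib, ← smul_add, add_sub_add_comm]
  map_smul' r f := by
    ext c
    simp only [PiLp.smul_apply, Pi.smul_apply, RingHom.id_apply, Finset.smul_sum, ← smul_sub]
    exact Finset.sum_congr rfl fun i _ => smul_comm _ _ _

/-- Extension of a cochain by `1` to all cells. -/
def extendOne {A : Type*} [CommGroup A] (f : Cochain K k A) (c : Cell d) : A :=
  if h : c ∈ K.cells.filter (·.2.card = k) then f ⟨c, h⟩ else 1

theorem cobG_apply_eq {A : Type*} [CommGroup A] (f : Cochain K k A) (c : KCell K (k + 1)) :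
    cobG A K k f c =
      ∏ i ∈ c.1.2, (extendOne f (c.1.upper i) / extendOne f (c.1.lower i)) ^ c.1.sign i := by
  rw [← Finset.prod_coe_sort]
  refine Finset.prod_congr rfl fun i _ => ?_
  have h1 : extendOne f (c.1.upper i) = f (c.upper i) := dif_pos (c.upper i).2
  have h2 : extendOne f (c.1.lower i) = f (c.lower i) := dif_pos (c.lower i).2
  rw [h1, h2]

theorem cobG_cobG {A : Type*} [CommGroup A] (K : Region d) (f : Cochain K 0 A) :
    cobG A K 1 (cobG A K 0 f) = 1 := by
  ext c
  have key : ∀ c' : Cell d, c' ∈ K.cells.filter (·.2.card = 1) →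
      extendOne (cobG A K 0 f) c' =
        ∏ i ∈ c'.2, (extendOne f (c'.upper i) / extendOne f (c'.lower i)) ^ c'.sign i := by
    intro c' h
    rw [extendOne, dif_pos h, cobG_apply_eq]
  have hc := (Finset.mem_filter.1 c.2).2
  have key1 : ∀ i ∈ c.1.2, extendOne (cobG A K 0 f) (c.1.upper i) = _ :=
    fun i hi => key _ (c.upper ⟨i, hi⟩).2
  have key2 : ∀ i ∈ c.1.2, extendOne (cobG A K 0 f) (c.1.lower i) = _ :=
    fun i hi => key _ (c.lower ⟨i, hi⟩).2
  rw [cobG_apply_eq, Finset.prod_congr rfl fun i hi => by rw [key1 i hi, key2 i hi]]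
  change _ = (1 : A)
  clear key key1 key2
  obtain ⟨⟨x, S⟩, hS⟩ := c
  simp only at hc ⊢
  obtain ⟨i, j, hij, rfl⟩ := Finset.card_eq_two.1 hc
  clear hc hS
  wlog hlt : i < j generalizing i j
  · rw [Finset.pair_comm]
    exact this j i hij.symm (lt_of_le_of_ne (not_lt.1 hlt) hij.symm)
  have e1 : ({i, j} : Finset (Fin d)).erase i = {j} := by
    ext a; simp; grind
  have e2 : ({i, j} : Finset (Fin d)).erase j = {i} := by
    ext a; simp; grind
  have s1 : ({i, j} : Finset (Fin d)).filter (· < i) = ∅ := by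
    ext a; simp; grind
  have s2 : ({i, j} : Finset (Fin d)).filter (· < j) = {i} := by
    ext a; simp; grind
  have s3 : ∀ a : Fin d, ({a} : Finset (Fin d)).filter (· < a) = ∅ := by
    intro a; ext b; simp; grind
  rw [Finset.prod_pair hij]
  simp only [Cell.upper, Cell.lower, Cell.sign, e1, e2, s1, s2, s3, Finset.prod_singleton,
    Finset.card_empty, Finset.card_singleton, pow_zero, pow_one, zpow_one, zpow_neg,
    Finset.erase_singleton, add_right_comm x (Pi.single j 1) (Pi.single i 1)]
  simp only [div_eq_mul_inv, mul_inv_rev, inv_inv]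
  generalize extendOne f (x + Pi.single i 1 + Pi.single j 1, ∅) = a1
  generalize extendOne f (x + Pi.single i 1, ∅) = a2
  generalize extendOne f (x + Pi.single j 1, ∅) = a3
  generalize extendOne f (x, ∅) = a4
  refine Eq.trans (b := (a1 * a1⁻¹) * (a2 * a2⁻¹) * (a3 * a3⁻¹) * (a4 * a4⁻¹)) ?_ ?_
  · simp only [mul_comm, mul_left_comm, mul_assoc]
  · simp

/-- Restriction of cochains. -/
def restrG (A : Type*) [CommGroup A] {K K' : Region d} (h : K ≤ K') (k : ℕ) :
    Cochain K' k A →* Cochain K k A where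
  toFun f c := f (c.incl h)
  map_one' := rfl
  map_mul' _ _ := rfl

/-- The pullback of cochains by the translation by `a`, from the translate of `K` to `K`. -/
def relabelG (A : Type*) [CommGroup A] (K : Region d) (a : Fin d → ℤ) (k : ℕ) :
    Cochain (K.shift a) k A →* Cochain K k A where
  toFun f c := f (c.shift a)
  map_one' := rfl
  map_mul' _ _ := rfl

theorem cobG_restrG (A : Type*) [CommGroup A] {K K' : Region d} (h : K ≤ K') (k : ℕ)
    (f : Cochain K' k A) : cobG A K k (restrG A h k f) = restrG A h (k + 1) (cobG A K' k f) := rfl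

theorem cobG_relabelG (A : Type*) [CommGroup A] (K : Region d) (a : Fin d → ℤ) (k : ℕ)
    (f : Cochain (K.shift a) k A) :
    cobG A K k (relabelG A K a k f) = relabelG A K a (k + 1) (cobG A (K.shift a) k f) := by
  ext c
  refine Finset.prod_congr rfl fun i _ => ?_
  have h1 : (c.upper i).shift a = (c.shift a).upper i :=
    Subtype.ext (Cell.shift_upper a c.1 i)
  change (f ((c.upper i).shift a) / _) ^ _ = _
  rw [h1]
  rfl

end Cochains

/-! ### The projective systems and their limits -/

section Systems

variable {d : ℕ} [NeZero d]

/-- The group `Im d₁` of exact 2-cochains on `K` with values in `G`. -/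
abbrev exactG (G : Type*) [CommGroup G] (K : Region d) : Subgroup (Cochain K 2 G) :=
  (cobG G K 1).range

/-- The group `C¹(K;G) / C⁰(K;G)` of 1-cochains modulo gauge transformations. -/
abbrev gaugeQuot (G : Type*) [CommGroup G] (K : Region d) : Type _ :=
  Cochain K 1 G ⧸ (cobG G K 0).range

/-- The space `Im d₁` of exact 2-cochains on `K` with values in the Lie algebra, with the inner
product restricted from the Euclidean inner product on 2-cochains. -/
abbrev exactLie (𝔤 : Type*) [NormedAddCommGroup 𝔤] [InnerProductSpace ℝ 𝔤] (K : Region d) :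
    Submodule ℝ (PiLp 2 (fun _ : KCell K 2 => 𝔤)) :=
  LinearMap.range (cobLie 𝔤 K 1)

/-- Restriction of exact 2-cochains. -/
def exactRes (G : Type*) [CommGroup G] (K K' : Region d) (h : K ≤ K') :
    exactG G K' →* exactG G K :=
  ((restrG G h 2).comp (exactG G K').subtype).codRestrict (exactG G K) (by
    rintro ⟨_, f, rfl⟩
    exact ⟨restrG G h 1 f, cobG_restrG G h 1 f⟩)

/-- Restriction of 1-cochains modulo gauge transformations. -/
def gaugeRes (G : Type*) [CommGroup G] (K K' : Region d) (h : K ≤ K') :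
    gaugeQuot G K' →* gaugeQuot G K :=
  QuotientGroup.map _ _ (restrG G h 1) (by
    rintro _ ⟨f, rfl⟩
    exact ⟨restrG G h 0 f, cobG_restrG G h 0 f⟩)

/-- Restriction of Lie algebra valued 2-cochains. -/
def restrLie (𝔤 : Type*) [NormedAddCommGroup 𝔤] [InnerProductSpace ℝ 𝔤] {K K' : Region d}
    (h : K ≤ K') :
    PiLp 2 (fun _ : KCell K' 2 => 𝔤) →ₗ[ℝ] PiLp 2 (fun _ : KCell K 2 => 𝔤) where
  toFun f := WithLp.toLp 2 fun c => f (c.incl h)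
  map_add' _ _ := rfl
  map_smul' _ _ := rfl

/-- Restriction of exact Lie algebra valued 2-cochains. -/
def exactLieRes (𝔤 : Type*) [NormedAddCommGroup 𝔤] [InnerProductSpace ℝ 𝔤] (K K' : Region d)
    (h : K ≤ K') : exactLie 𝔤 K' →ₗ[ℝ] exactLie 𝔤 K :=
  (restrLie 𝔤 h).restrict (by
    rintro _ ⟨f, rfl⟩
    exact ⟨fun c => f (c.incl h), rfl⟩)

/-- The coboundary operator induced on the quotient, as a map onto `Im d₁`. -/
def cobBar (G : Type*) [CommGroup G] (K : Region d) : gaugeQuot G K →* exactG G K :=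
  QuotientGroup.lift _ (cobG G K 1).rangeRestrict (by
    rintro _ ⟨f, rfl⟩
    exact Subtype.ext (cobG_cobG K f))

/-- The translation `C¹(K - a;G) / C⁰(K - a;G) → C¹(K;G) / C⁰(K;G)`, sending the class of `f` to
that of `c ↦ f (c - a)`. -/
def gaugeShift (G : Type*) [CommGroup G] (a : Fin d → ℤ) (K : Region d) :
    gaugeQuot G (K.shift (-a)) →* gaugeQuot G K :=
  QuotientGroup.map _ _ (relabelG G K (-a) 1) (by
    rintro _ ⟨f, rfl⟩
    exact ⟨relabelG G K (-a) 0 f, cobG_relabelG G K (-a) 0 f⟩)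

variable (d) in
/-- The limit of the groups of exact 2-cochains. -/
abbrev exactLim (G : Type*) [CommGroup G] : Subgroup (∀ K : Region d, exactG G K) :=
  projLimGroup (fun K : Region d => exactG G K) (exactRes G)

variable (d) in
/-- The limit of the groups of 1-cochains modulo gauge transformations. -/
abbrev gaugeLim (G : Type*) [CommGroup G] : Subgroup (∀ K : Region d, gaugeQuot G K) :=
  projLimGroup (fun K : Region d => gaugeQuot G K) (gaugeRes G)

variable (d) in
/-- The limit of the Hilbert spaces of exact Lie algebra valued 2-cochains. -/
abbrev exactLieLim (𝔤 : Type*) [NormedAddCommGroup 𝔤] [InnerProductSpace ℝ 𝔤] :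
    Submodule ℝ (lp (fun K : Region d => exactLie 𝔤 K) ∞) :=
  projLimHilb (fun K : Region d => exactLie 𝔤 K) (exactLieRes 𝔤)

instance (G : Type*) [CommGroup G] [TopologicalSpace G] : MeasurableSpace (exactLim d G) :=
  borel _

instance (G : Type*) [CommGroup G] [TopologicalSpace G] : BorelSpace (exactLim d G) := ⟨rfl⟩

instance (G : Type*) [CommGroup G] [TopologicalSpace G] : MeasurableSpace (gaugeLim d G) :=
  borel _

instance (G : Type*) [CommGroup G] [TopologicalSpace G] : BorelSpace (gaugeLim d G) := ⟨rfl⟩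

variable (d) in
/-- The limit of the coboundary operators. -/
def cobLim (G : Type*) [CommGroup G] : gaugeLim d G →* exactLim d G where
  toFun x := ⟨fun K => cobBar G K (x.1 K), fun K K' h => by
    change exactRes G K K' h (cobBar G K' (x.1 K')) = cobBar G K (x.1 K)
    rw [← x.2 K K' h]
    induction x.1 K' using QuotientGroup.induction_on with
    | H f => rfl⟩
  map_one' := Subtype.ext (funext fun K => map_one (cobBar G K))
  map_mul' x y := Subtype.ext (funext fun K => map_mul (cobBar G K) (x.1 K) (y.1 K))

/-- Lattice translation by `a` on the limit of the groups `C¹(K;G) / C⁰(K;G)`. -/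
def translate (G : Type*) [CommGroup G] (a : Fin d → ℤ) (x : gaugeLim d G) : gaugeLim d G :=
  ⟨fun K => gaugeShift G a K (x.1 (K.shift (-a))), fun K K' h => by
    change gaugeRes G K K' h (gaugeShift G a K' (x.1 (K'.shift (-a)))) =
      gaugeShift G a K (x.1 (K.shift (-a)))
    rw [← x.2 _ _ (Region.shift_mono (-a) h)]
    induction x.1 (K'.shift (-a)) using QuotientGroup.induction_on with
    | H f => rfl⟩

end Systems

/-! ### The infinite lattice measure -/

section LieGroup

variable {d : ℕ} [NeZero d]
  {E : Type*} [NormedAddCommGroup E] [NormedSpace ℝ E]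
  {G : Type*} [CommGroup G] [TopologicalSpace G] [ChartedSpace E G]
  {𝔤 : Type*} [NormedAddCommGroup 𝔤] [InnerProductSpace ℝ 𝔤]

/-- `γ` is the one-parameter subgroup `t ↦ exp (t v)` of `G`: a homomorphism with velocity `v`
at time `0` (where `γ 0 = 1`). -/
def IsOneParam (γ : ℝ → G) (v : GroupLieAlgebra 𝓘(ℝ, E) G) : Prop :=
  (∀ s t, γ (s + t) = γ s * γ t) ∧
    HasMFDerivAt 𝓘(ℝ, ℝ) 𝓘(ℝ, E) γ 0 (ContinuousLinearMap.toSpanSingleton ℝ (v : E))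

/-- `ξ` is the element of the dual lattice corresponding to the character `χ` of `Im d₁`:
`χ (exp (t v)) = exp (2πi t ξ(v))`.  Here the Lie algebra of `Im d₁` is the space of exact
2-cochains with values in `𝔤`, which is identified with the Lie algebra of `G` by `φ`. -/
def IsDualVector (φ : 𝔤 ≃ₗ[ℝ] GroupLieAlgebra 𝓘(ℝ, E) G) (K : Region d)
    (χ : PontryaginDual (exactG G K)) (ξ : exactLie 𝔤 K →L[ℝ] ℝ) : Prop :=
  ∀ (v : exactLie 𝔤 K) (γ : ℝ → exactG G K),
    (∀ p : KCell K 2, IsOneParam (fun t => (γ t).1 p) (φ (v.1 p))) →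
      ∀ t : ℝ, χ (γ t) = Circle.exp (2 * Real.pi * (t * ξ v))

open Classical in
/-- The natural inclusion of the dual of `Im d₁` into the dual of its Lie algebra. -/
def dualVector (φ : 𝔤 ≃ₗ[ℝ] GroupLieAlgebra 𝓘(ℝ, E) G) (K : Region d)
    (χ : PontryaginDual (exactG G K)) : exactLie 𝔤 K →L[ℝ] ℝ :=
  if h : ∃ ξ, IsDualVector φ K χ ξ then h.choose else 0

variable (d) in
/-- The map from the characters of the limit group to the dual of the limit Hilbert space. -/
def dualVectorLim (φ : 𝔤 ≃ₗ[ℝ] GroupLieAlgebra 𝓘(ℝ, E) G)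
    (χ : PontryaginDual (exactLim d G)) : exactLieLim d 𝔤 →L[ℝ] ℝ :=
  limJ (fun K : Region d => exactG G K) (exactRes G) (fun K : Region d => exactLie 𝔤 K)
    (exactLieRes 𝔤) (dualVector φ) χ

variable (d) in
/-- The limit heat kernel measure on the limit of the groups of exact 2-cochains. -/
def limitHeatKernelMeasure (φ : 𝔤 ≃ₗ[ℝ] GroupLieAlgebra 𝓘(ℝ, E) G) (β : ℝ) :
    Measure (exactLim d G) :=
  heatKernelMeasure (V := exactLieLim d 𝔤) (dualVectorLim d φ) β

variable (d) in
/-- The modified Villain measure on the infinite lattice: the pushforward of the limit heat kernel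
measure by the inverse of the limit coboundary operator. -/
def villainMeasure (φ : 𝔤 ≃ₗ[ℝ] GroupLieAlgebra 𝓘(ℝ, E) G) (β : ℝ) : Measure (gaugeLim d G) :=
  (limitHeatKernelMeasure d φ β).map (Function.invFun (cobLim d G))

end LieGroup

end Villain

end

/-! Everything reduces to the exponential map. On a connected Abelian Lie group `G` it is an open
surjective homomorphism `𝔤 → G` with discrete kernel (`map_expMap_nhds_zero`, `expMap_surjective`);
when `G` is compact the kernel is a lattice, so characters separate points
(`exists_character_ne_one`). Applied cell by cell, it gives a continuous homomorphism `limExp` from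
the limit Hilbert space to the limit group. A character composed with it is a character of a real
vector space, hence `exp (2πi ξ)` for a unique continuous functional `ξ`, and this `ξ` is
`dualVectorLim` (`apply_limExp`, `eq_dualVectorLim`). That identity replaces every computation with
a chosen level `K`.

Existence: the Gaussian of variance `2β` on a finite-dimensional subspace, pushed forward by the
exponential map, has the prescribed Fourier transform with `J χ` restricted to the subspace. The
limit group is compact, so these measures have a weak limit along an ultrafilter of growing
subspaces, and the norms of the restrictions converge to `‖J χ‖` (`exists_isHeatKernelMeasure`).
Uniqueness: trigonometric polynomials form a separating star-subalgebra
(`measure_ext_of_characters`).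

The coboundary is injective modulo gauge transformations because a closed 1-cochain on a
contractible complex is exact. This holds for arbitrary Abelian coefficients: the cochain defines a
flat bundle with discrete fibre, that is a covering, which has a section over a contractible base
(`exists_primitive`). Bijectivity passes to the limits, and compactness makes the continuous
bijection a homeomorphism.

Invariance: a translation contracts the Hilbert space, and so does its inverse, so it preserves `‖J
χ‖`; by uniqueness it preserves the heat kernel measure, and the homeomorphism transports this to
the gauge quotient. -/

namespace Villain

open scoped Topology

/-! ### One-parameter subgroups as integral curves of invariant vector fields -/

section OneParam
variable {E : Type*} [NormedAddCommGroup E] [NormedSpace ℝ E]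
  {G : Type*} [CommGroup G] [TopologicalSpace G] [ChartedSpace E G]
  {γ δ : ℝ → G} {v w : GroupLieAlgebra 𝓘(ℝ, E) G}

theorem IsOneParam.zero (h : IsOneParam γ v) : γ 0 = 1 := by
  simpa using h.1 0 0

/-- The derivative of a left multiplication, as an endomorphism of the model space. -/
noncomputable def mulLeftDeriv (E : Type*) [NormedAddCommGroup E] [NormedSpace ℝ E] {G : Type*} [CommGroup G]
    [TopologicalSpace G] [ChartedSpace E G] (g h : G) : E →L[ℝ] E :=
  mfderiv 𝓘(ℝ, E) 𝓘(ℝ, E) (g * ·) h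

variable [LieGroup 𝓘(ℝ, E) ∞ G]

variable (E G) in
theorem lieGroup_minSmoothness : LieGroup 𝓘(ℝ, E) (minSmoothness ℝ 3) G :=
  LieGroup.of_le (n := ∞) (by simp; exact WithTop.coe_le_coe.2 le_top)

theorem hasMFDerivAt_mul_left (g h : G) :
    HasMFDerivAt 𝓘(ℝ, E) 𝓘(ℝ, E) (g * · : G → G) h (mulLeftDeriv E g h) :=
  ((contMDiff_mul_left (n := ∞)).contMDiffAt.mdifferentiableAt (by simp)).hasMFDerivAt

theorem mulLeftDeriv_mul (g h k : G) :
    mulLeftDeriv E (g * h) k = (mulLeftDeriv E g (h * k)).comp (mulLeftDeriv E h k) := by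
  have h1 := (hasMFDerivAt_mul_left (E := E) g (h * k)).comp k (hasMFDerivAt_mul_left h k)
  have h2 : ((g * ·) ∘ (h * ·) : G → G) = (g * h * ·) := by
    ext; simp [mul_assoc]
  rw [h2] at h1
  exact h1.mfderiv

theorem mulLeftDeriv_one (k : G) :
    mulLeftDeriv E (1 : G) k = ContinuousLinearMap.id ℝ E := by
  have h1 := hasMFDerivAt_mul_left (E := E) (1 : G) k
  have h2 : ((1 : G) * ·) = (id : G → G) := by
    ext; simp
  rw [h2] at h1
  exact h1.mfderiv.symm.trans mfderiv_id

/-- The chain rule together with the invariance of the field: left translation carries integral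
curves to integral curves. -/
theorem HasMFDerivAt.mul_left_integralCurve (g : G) {t : ℝ}
    (h : HasMFDerivAt 𝓘(ℝ, ℝ) 𝓘(ℝ, E) γ t
      ((1 : ℝ →L[ℝ] ℝ).smulRight (mulInvariantVectorField v (γ t)))) :
    HasMFDerivAt 𝓘(ℝ, ℝ) 𝓘(ℝ, E) (fun t => g * γ t) t
      ((1 : ℝ →L[ℝ] ℝ).smulRight (mulInvariantVectorField v (g * γ t))) := by
  have h1 := (hasMFDerivAt_mul_left (E := E) g (γ t)).comp t h
  refine h1.congr_mfderiv ?_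
  refine ContinuousLinearMap.ext fun (s : ℝ) => ?_
  change mulLeftDeriv E g (γ t) (s • mulLeftDeriv E (γ t) 1 (v : E)) =
    s • mulLeftDeriv E (g * γ t) 1 (v : E)
  rw [mulLeftDeriv_mul, mul_one, map_smul]
  rfl

/-- Since `γ s = γ t * γ (s - t)`, the velocity at `t` is the left translate by `γ t` of the
velocity at `0`. -/
theorem IsOneParam.isMIntegralCurve (h : IsOneParam γ v) :
    IsMIntegralCurve (I := 𝓘(ℝ, E)) γ (mulInvariantVectorField v) := by
  intro t
  have h0 : HasMFDerivAt 𝓘(ℝ, ℝ) 𝓘(ℝ, E) γ 0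
      ((1 : ℝ →L[ℝ] ℝ).smulRight (mulInvariantVectorField v (γ 0))) := by
    refine h.2.congr_mfderiv (ContinuousLinearMap.ext fun (s : ℝ) => ?_)
    change s • (v : E) = s • mulLeftDeriv E (γ 0) 1 (v : E)
    rw [h.zero, mulLeftDeriv_one]
    rfl
  have h1 := HasMFDerivAt.mul_left_integralCurve (γ t) h0
  have h2 : γ = (fun s => γ t * γ s) ∘ (fun s => s - t) := by
    ext s; simp [← h.1]
  have h3 : HasMFDerivAt 𝓘(ℝ, ℝ) 𝓘(ℝ, ℝ) (fun s : ℝ => s - t) t (ContinuousLinearMap.id ℝ ℝ) :=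
    ((hasFDerivAt_id t).sub_const t).hasMFDerivAt
  have h4 : ∀ r, r = 0 → HasMFDerivAt 𝓘(ℝ, ℝ) 𝓘(ℝ, E) (fun s => γ t * γ s) r
      ((1 : ℝ →L[ℝ] ℝ).smulRight (mulInvariantVectorField v (γ t * γ r))) := by
    rintro r rfl; exact h1
  have h5 := HasMFDerivAt.comp (f := fun s : ℝ => s - t) t (h4 (t - t) (sub_self t)) h3
  rw [← h2] at h5
  refine h5.congr_mfderiv (ContinuousLinearMap.ext fun (s : ℝ) => ?_)
  change s • mulLeftDeriv E (γ t * γ (t - t)) 1 (v : E) = s • mulLeftDeriv E (γ t) 1 (v : E)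
  rw [← h.1, add_sub_cancel]

theorem contMDiff_one_mulInvariantVectorField (v : GroupLieAlgebra 𝓘(ℝ, E) G) :
    ContMDiff 𝓘(ℝ, E) 𝓘(ℝ, E).tangent 1
      (fun g : G => (⟨g, mulInvariantVectorField v g⟩ : TangentBundle 𝓘(ℝ, E) G)) := by
  have := lieGroup_minSmoothness E G
  exact (contMDiff_mulInvariantVectorField v).of_le (by simp)

variable (E G) in
theorem isManifold_one : IsManifold 𝓘(ℝ, E) 1 G := IsManifold.of_le (n := ∞) (by simp)

theorem IsOneParam.eq [T2Space G] (hγ : IsOneParam γ v) (hδ : IsOneParam δ v) : γ = δ := by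
  have := isManifold_one E G
  exact isMIntegralCurve_Ioo_eq_of_contMDiff_boundaryless (I := 𝓘(ℝ, E)) (t₀ := 0)
    (contMDiff_one_mulInvariantVectorField v) hγ.isMIntegralCurve hδ.isMIntegralCurve
    (by rw [hγ.zero, hδ.zero])

/-- Left translates of one local integral curve through `1` give integral curves through every point
on the same time interval, and such a uniform lifetime extends the curve to all of `ℝ`. The
homomorphism law is uniqueness: `δ (t + s)` and `δ s * δ t` solve the same equation from the same
point. -/
theorem exists_isOneParam [CompleteSpace E] [T2Space G] (v : GroupLieAlgebra 𝓘(ℝ, E) G) :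
    ∃ γ : ℝ → G, IsOneParam γ v := by
  have := isManifold_one E G
  have hv := contMDiff_one_mulInvariantVectorField v
  obtain ⟨γ, hγ0, hγ⟩ := exists_isMIntegralCurveAt_of_contMDiffAt_boundaryless (I := 𝓘(ℝ, E)) 0
    (hv.contMDiffAt (x := 1))
  rw [isMIntegralCurveAt_iff'] at hγ
  obtain ⟨ε, hε, hγ⟩ := hγ
  rw [Real.ball_eq_Ioo, zero_sub, zero_add] at hγ
  obtain ⟨δ, hδ0, hδ⟩ := exists_isMIntegralCurve_of_isMIntegralCurveOn hv hε
    (fun x => ⟨fun t => x * γ t, by simp [hγ0], fun t ht =>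
      ((HasMFDerivAt.mul_left_integralCurve x
        ((hγ t ht).hasMFDerivAt (isOpen_Ioo.mem_nhds ht))).hasMFDerivWithinAt)⟩) (1 : G)
  refine ⟨δ, fun s t => ?_, ?_⟩
  · have h1 : IsMIntegralCurve (I := 𝓘(ℝ, E)) (δ ∘ (· + s)) (mulInvariantVectorField v) :=
      hδ.comp_add s
    have h2 : IsMIntegralCurve (I := 𝓘(ℝ, E)) (fun t => δ s * δ t) (mulInvariantVectorField v) :=
      fun t => HasMFDerivAt.mul_left_integralCurve _ (hδ t)
    have := isMIntegralCurve_Ioo_eq_of_contMDiff_boundaryless (I := 𝓘(ℝ, E)) (t₀ := 0) hv h1 h2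
      (by simp [hδ0])
    simpa [add_comm] using congrFun this t
  · refine (hδ 0).congr_mfderiv (ContinuousLinearMap.ext fun (s : ℝ) => ?_)
    change s • mulLeftDeriv E (δ 0) 1 (v : E) = s • (v : E)
    rw [hδ0, mulLeftDeriv_one]
    rfl

theorem IsOneParam.continuous (h : IsOneParam γ v) : Continuous γ :=
  h.isMIntegralCurve.continuous

end OneParam

/-- The increment `F x - F y` equals `m (F y, F (x - y)) - m (F y, c)`. Strict differentiability of
`m` replaces it by `F (x - y) - c` up to `o(x - y)`, so differentiability at the single point `0`
already controls pairs of points. Strictness is what the inverse function theorem needs. -/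
theorem hasStrictFDerivAt_of_eventually_add {E V : Type*} [NormedAddCommGroup E] [NormedSpace ℝ E]
    [NormedAddCommGroup V] [NormedSpace ℝ V] {m : E × E → E} {c : E}
    (hm : HasStrictFDerivAt m (ContinuousLinearMap.fst ℝ E E + ContinuousLinearMap.snd ℝ E E)
      (c, c)) {F : V → E} {L : V →L[ℝ] E} (hF0 : F 0 = c) (hF : HasFDerivAt F L 0)
    (hadd : ∀ᶠ p : V × V in 𝓝 (0, 0), m (F p.2, F (p.1 - p.2)) = F p.1)
    (hone : ∀ᶠ p : V × V in 𝓝 (0, 0), m (F p.2, c) = F p.2) : HasStrictFDerivAt F L 0 := by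
  have hFc : Filter.Tendsto F (𝓝 0) (𝓝 c) := hF0 ▸ hF.continuousAt
  have hsub : Filter.Tendsto (fun p : V × V => p.1 - p.2) (𝓝 (0, 0)) (𝓝 0) := by
    have : Continuous (fun p : V × V => p.1 - p.2) := by fun_prop
    have h := this.tendsto (0, 0)
    rwa [sub_self] at h
  have hsnd : Filter.Tendsto (fun p : V × V => p.2) (𝓝 (0, 0)) (𝓝 0) :=
    continuous_snd.tendsto (0, 0)
  have h1 := hm.isLittleO.comp_tendsto (k := fun p : V × V =>
    ((F p.2, F (p.1 - p.2)), (F p.2, c))) (l' := 𝓝 (0, 0)) (by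
      refine Filter.Tendsto.prodMk_nhds ?_ ?_
      · exact (hFc.comp hsnd).prodMk_nhds (hFc.comp hsub)
      · exact (hFc.comp hsnd).prodMk_nhds tendsto_const_nhds)
  have h2 : (fun p : V × V => F (p.1 - p.2) - c - L (p.1 - p.2)) =o[𝓝 (0, 0)]
      fun p => p.1 - p.2 := by
    have := hF.isLittleO.comp_tendsto (k := fun p : V × V => p.1 - p.2) hsub
    simpa [Function.comp_def, hF0] using this
  have h3 : (fun p : V × V => F (p.1 - p.2) - c) =O[𝓝 (0, 0)] fun p => p.1 - p.2 := by
    have := h2.isBigO.add (L.isBigO_comp (fun p : V × V => p.1 - p.2) (𝓝 (0, 0)))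
    simpa using this
  have h4 : (fun p : V × V => F p.1 - F p.2 - (F (p.1 - p.2) - c)) =o[𝓝 (0, 0)]
      fun p => p.1 - p.2 := by
    refine (Asymptotics.IsLittleO.congr' (h1.trans_isBigO ?_) ?_ Filter.EventuallyEq.rfl)
    · refine Asymptotics.IsBigO.congr_left (Asymptotics.IsBigO.prod_left
        (Asymptotics.isBigO_zero _ _) h3) fun p => ?_
      simp
    · filter_upwards [hadd, hone] with p e1 e2
      simp [e1, e2]
  refine HasStrictFDerivAt.of_isLittleO ?_
  refine (h4.add h2).congr_left fun p => ?_
  abel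

/-! ### Multiplication in the chart at the identity -/

section ChartAtOne
variable {E : Type*} [NormedAddCommGroup E] [NormedSpace ℝ E]
  {G : Type*} [CommGroup G] [TopologicalSpace G] [ChartedSpace E G]
  {V : Type*} [NormedAddCommGroup V] [NormedSpace ℝ V]

theorem hasMFDerivAt_zero_iff {f : V → G} (hf : f 0 = 1) {L : V →L[ℝ] E} :
    HasMFDerivAt 𝓘(ℝ, V) 𝓘(ℝ, E) f 0 L ↔
      ContinuousAt f 0 ∧ HasFDerivAt (fun x => extChartAt 𝓘(ℝ, E) (1 : G) (f x)) L 0 := by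
  have : writtenInExtChartAt 𝓘(ℝ, V) 𝓘(ℝ, E) (0 : V) f =
      fun x => extChartAt 𝓘(ℝ, E) (1 : G) (f x) := by
    ext x
    simp only [writtenInExtChartAt, hf, Function.comp_apply, extChartAt_model_space_eq_id,
      PartialEquiv.refl_symm, PartialEquiv.refl_coe, id_eq]
  unfold HasMFDerivAt
  rw [this]
  simp only [extChartAt_model_space_eq_id, PartialEquiv.refl_coe, id_eq,
    modelWithCornersSelf_coe, Set.range_id]
  exact Iff.rfl.and hasFDerivWithinAt_univ

variable (E G) in
/-- The multiplication of `G` near `1`, read in the chart at `1`. -/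
noncomputable def chartMul (p : E × E) : E :=
  extChartAt 𝓘(ℝ, E) (1 : G)
    ((extChartAt 𝓘(ℝ, E) (1 : G)).symm p.1 * (extChartAt 𝓘(ℝ, E) (1 : G)).symm p.2)

variable (E G) in
/-- The coordinates of `1` in the chart at `1`. -/
noncomputable def chartOne : E := extChartAt 𝓘(ℝ, E) (1 : G) 1

variable (E G) in
theorem chart_symm_chartOne : (extChartAt 𝓘(ℝ, E) (1 : G)).symm (chartOne E G) = 1 :=
  extChartAt_to_inv (I := 𝓘(ℝ, E)) (1 : G)

variable [LieGroup 𝓘(ℝ, E) ∞ G]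

variable (E G) in
theorem contDiffAt_chartMul : ContDiffAt ℝ 1 (chartMul E G) (chartOne E G, chartOne E G) := by
  have := isManifold_one E G
  rw [← contMDiffAt_iff_contDiffAt]
  have h1 : ContMDiffAt 𝓘(ℝ, E) 𝓘(ℝ, E) 1 (extChartAt 𝓘(ℝ, E) (1 : G)).symm (chartOne E G) :=
    (contMDiffOn_extChartAt_symm (1 : G)).contMDiffAt (extChartAt_target_mem_nhds (1 : G))
  have h2 : ContMDiffAt 𝓘(ℝ, E × E) 𝓘(ℝ, E) 1
      (fun p : E × E => (extChartAt 𝓘(ℝ, E) (1 : G)).symm p.1 *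
        (extChartAt 𝓘(ℝ, E) (1 : G)).symm p.2) (chartOne E G, chartOne E G) := by
    have : LieGroup 𝓘(ℝ, E) 1 G := LieGroup.of_le (n := ∞) (by simp)
    exact (ContMDiffAt.comp (chartOne E G, chartOne E G) h1
      contDiff_fst.contMDiff.contMDiffAt).mul
      (ContMDiffAt.comp (chartOne E G, chartOne E G) h1 contDiff_snd.contMDiff.contMDiffAt)
  refine ContMDiffAt.comp (g := extChartAt 𝓘(ℝ, E) (1 : G)) (chartOne E G, chartOne E G) ?_ h2
  refine contMDiffAt_extChartAt' ?_
  rw [chart_symm_chartOne, mul_one]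
  exact mem_chart_source E (1 : G)

variable (E G) in
-- The coordinates of `1` are a two-sided unit for `chartMul` nearby, so both partial derivatives
-- are the identity.
theorem hasStrictFDerivAt_chartMul :
    HasStrictFDerivAt (chartMul E G)
      (ContinuousLinearMap.fst ℝ E E + ContinuousLinearMap.snd ℝ E E)
      (chartOne E G, chartOne E G) := by
  have h := (contDiffAt_chartMul E G).hasStrictFDerivAt (by simp)
  set M := fderiv ℝ (chartMul E G) (chartOne E G, chartOne E G)
  have hev : ∀ᶠ a in 𝓝 (chartOne E G), a ∈ (extChartAt 𝓘(ℝ, E) (1 : G)).target :=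
    extChartAt_target_mem_nhds (1 : G)
  have h1 : M.comp (.inl ℝ E E) = .id ℝ E := by
    have := h.hasFDerivAt.comp (f := fun a => (a, chartOne E G)) (chartOne E G)
      (hasFDerivAt_prodMk_left (𝕜 := ℝ) (chartOne E G) (chartOne E G))
    refine this.unique ((hasFDerivAt_id _).congr_of_eventuallyEq ?_)
    filter_upwards [hev] with a ha
    simp only [chartMul, Function.comp_apply]
    rw [chart_symm_chartOne, mul_one, (extChartAt 𝓘(ℝ, E) (1 : G)).right_inv ha, id]
  have h2 : M.comp (.inr ℝ E E) = .id ℝ E := by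
    have := h.hasFDerivAt.comp (chartOne E G)
      (hasFDerivAt_prodMk_right (𝕜 := ℝ) (chartOne E G) (chartOne E G))
    refine this.unique ((hasFDerivAt_id _).congr_of_eventuallyEq ?_)
    filter_upwards [hev] with a ha
    simp only [chartMul, Function.comp_apply]
    rw [chart_symm_chartOne, one_mul, (extChartAt 𝓘(ℝ, E) (1 : G)).right_inv ha, id]
  convert! h using 1
  ext x
  · simpa using (congrArg (· x) h1).symm
  · simpa using (congrArg (· x) h2).symm

omit [LieGroup 𝓘(ℝ, E) ∞ G] in
theorem chartMul_chart {g h : G} (hg : g ∈ (extChartAt 𝓘(ℝ, E) (1 : G)).source)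
    (hh : h ∈ (extChartAt 𝓘(ℝ, E) (1 : G)).source) :
    chartMul E G (extChartAt 𝓘(ℝ, E) (1 : G) g, extChartAt 𝓘(ℝ, E) (1 : G) h) =
      extChartAt 𝓘(ℝ, E) (1 : G) (g * h) := by
  simp only [chartMul]
  rw [(extChartAt 𝓘(ℝ, E) (1 : G)).left_inv hg, (extChartAt 𝓘(ℝ, E) (1 : G)).left_inv hh]

omit [NormedSpace ℝ V] [LieGroup 𝓘(ℝ, E) ∞ G] in
theorem eventually_mem_chart_source {f : V → G} (hf : f 0 = 1) (hc : ContinuousAt f 0) :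
    ∀ᶠ x in 𝓝 0, f x ∈ (extChartAt 𝓘(ℝ, E) (1 : G)).source :=
  hc.eventually (by rw [hf]; exact extChartAt_source_mem_nhds (1 : G))

theorem hasMFDerivAt_mul_of_eq_one {f g : V → G} (hf1 : f 0 = 1) (hg1 : g 0 = 1)
    {L L' : V →L[ℝ] E} (hf : HasMFDerivAt 𝓘(ℝ, V) 𝓘(ℝ, E) f 0 L)
    (hg : HasMFDerivAt 𝓘(ℝ, V) 𝓘(ℝ, E) g 0 L') :
    HasMFDerivAt 𝓘(ℝ, V) 𝓘(ℝ, E) (fun x => f x * g x) 0 (L + L') := by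
  have := topologicalGroup_of_lieGroup 𝓘(ℝ, E) ∞ (G := G)
  rw [hasMFDerivAt_zero_iff hf1] at hf
  rw [hasMFDerivAt_zero_iff hg1] at hg
  rw [hasMFDerivAt_zero_iff (by simp [hf1, hg1])]
  refine ⟨hf.1.mul hg.1, ?_⟩
  have h1 := hf.2.prodMk hg.2
  have h2 : HasFDerivAt (chartMul E G)
      (ContinuousLinearMap.fst ℝ E E + ContinuousLinearMap.snd ℝ E E)
      (extChartAt 𝓘(ℝ, E) (1 : G) (f 0), extChartAt 𝓘(ℝ, E) (1 : G) (g 0)) := by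
    rw [hf1, hg1]; exact (hasStrictFDerivAt_chartMul E G).hasFDerivAt
  have h3 := h2.comp (0 : V) h1
  have h4 : (ContinuousLinearMap.fst ℝ E E + ContinuousLinearMap.snd ℝ E E).comp (L.prod L') =
      L + L' := by ext; simp
  rw [h4] at h3
  refine h3.congr_of_eventuallyEq ?_
  filter_upwards [eventually_mem_chart_source (E := E) hf1 hf.1,
    eventually_mem_chart_source (E := E) hg1 hg.1] with x hx hy
  exact (chartMul_chart hx hy).symm

/-- A homomorphism into `G` that is differentiable at `0` is strictly differentiable there. -/
theorem hasStrictFDerivAt_of_add {f : V → G} (hadd : ∀ x y, f (x + y) = f x * f y)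
    {L : V →L[ℝ] E} (hf : HasMFDerivAt 𝓘(ℝ, V) 𝓘(ℝ, E) f 0 L) :
    HasStrictFDerivAt (fun x => extChartAt 𝓘(ℝ, E) (1 : G) (f x)) L 0 := by
  have hf1 : f 0 = 1 := by simpa using hadd 0 0
  rw [hasMFDerivAt_zero_iff hf1] at hf
  have hs := eventually_mem_chart_source (E := E) hf1 hf.1
  have hsub : Filter.Tendsto (fun p : V × V => p.1 - p.2) (𝓝 (0, 0)) (𝓝 0) := by
    have : Continuous (fun p : V × V => p.1 - p.2) := by fun_prop
    have h := this.tendsto (0, 0)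
    rwa [sub_self] at h
  have hsnd : Filter.Tendsto (fun p : V × V => p.2) (𝓝 (0, 0)) (𝓝 0) :=
    continuous_snd.tendsto (0, 0)
  refine hasStrictFDerivAt_of_eventually_add (hasStrictFDerivAt_chartMul E G) ?_ hf.2 ?_ ?_
  · rw [hf1]; rfl
  · filter_upwards [hsnd.eventually hs, hsub.eventually hs] with p hq hpq
    rw [chartMul_chart hq hpq, ← hadd, add_sub_cancel]
  · filter_upwards [hsnd.eventually hs] with p hq
    have := chartMul_chart (E := E) hq (mem_extChartAt_source (1 : G))
    rwa [mul_one] at this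

end ChartAtOne

/-! ### The exponential map of an Abelian Lie group -/

section Exp
variable {E : Type*} [NormedAddCommGroup E] [NormedSpace ℝ E]
  {G : Type*} [CommGroup G] [TopologicalSpace G] [ChartedSpace E G] [LieGroup 𝓘(ℝ, E) ∞ G]
  {𝔤 : Type*} [NormedAddCommGroup 𝔤] [InnerProductSpace ℝ 𝔤]
  {γ δ : ℝ → G} {v w : GroupLieAlgebra 𝓘(ℝ, E) G}

/-- Commutativity of `G` makes the product a homomorphism; this is the source of the additivity of
the exponential map. -/
theorem IsOneParam.mul (hγ : IsOneParam γ v) (hδ : IsOneParam δ w) :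
    IsOneParam (fun t => γ t * δ t) (v + w) := by
  refine ⟨fun s t => by simp only [hγ.1, hδ.1, mul_mul_mul_comm], ?_⟩
  have := hasMFDerivAt_mul_of_eq_one hγ.zero hδ.zero hγ.2 hδ.2
  refine this.congr_mfderiv (ContinuousLinearMap.ext fun (s : ℝ) => ?_)
  exact (smul_add s (v : E) (w : E)).symm

omit [LieGroup 𝓘(ℝ, E) ∞ G] in
theorem IsOneParam.comp_mul (hγ : IsOneParam γ v) (c : ℝ) :
    IsOneParam (fun t => γ (t * c)) (c • v) := by
  refine ⟨fun s t => by simp only [add_mul, hγ.1], ?_⟩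
  have h0 : HasMFDerivAt 𝓘(ℝ, ℝ) 𝓘(ℝ, ℝ) (fun s : ℝ => s * c) 0
      ((ContinuousLinearMap.id ℝ ℝ).smulRight c) :=
    ((hasFDerivAt_id (𝕜 := ℝ) (0 : ℝ)).mul_const' c).hasMFDerivAt
  have h1 : ∀ r : ℝ, r = 0 → HasMFDerivAt 𝓘(ℝ, ℝ) 𝓘(ℝ, E) γ r
      (ContinuousLinearMap.toSpanSingleton ℝ (v : E)) := by
    rintro r rfl; exact hγ.2
  have := HasMFDerivAt.comp (f := fun s : ℝ => s * c) (0 : ℝ) (h1 (0 * c) (zero_mul c)) h0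
  refine this.congr_mfderiv (ContinuousLinearMap.ext fun (s : ℝ) => ?_)
  change (s • c) • (v : E) = s • (c • (v : E))
  rw [smul_assoc]

variable [FiniteDimensional ℝ E] [T2Space G]

/-- The exponential map of a compact Abelian Lie group, from a space identified with its Lie
algebra. -/
noncomputable def expMap (φ : 𝔤 ≃ₗ[ℝ] GroupLieAlgebra 𝓘(ℝ, E) G) (x : 𝔤) : G :=
  haveI := FiniteDimensional.complete ℝ E
  (exists_isOneParam (φ x)).choose 1

variable (φ : 𝔤 ≃ₗ[ℝ] GroupLieAlgebra 𝓘(ℝ, E) G)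

theorem IsOneParam.one_eq_expMap {x : 𝔤} (h : IsOneParam γ (φ x)) : γ 1 = expMap φ x := by
  have := FiniteDimensional.complete ℝ E
  rw [h.eq (exists_isOneParam (φ x)).choose_spec]
  rfl

theorem IsOneParam.eq_expMap {x : 𝔤} (h : IsOneParam γ (φ x)) (t : ℝ) :
    γ t = expMap φ (t • x) := by
  have h1 := h.comp_mul t
  rw [← map_smul] at h1
  simpa using h1.one_eq_expMap φ

theorem isOneParam_expMap (x : 𝔤) : IsOneParam (fun t => expMap φ (t • x)) (φ x) := by
  have := FiniteDimensional.complete ℝ E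
  obtain ⟨γ, hγ⟩ := exists_isOneParam (φ x)
  have : (fun t => expMap φ (t • x)) = γ := by
    ext t; rw [hγ.eq_expMap φ]
  rwa [this]

theorem expMap_add (x y : 𝔤) : expMap φ (x + y) = expMap φ x * expMap φ y := by
  have h := (isOneParam_expMap φ x).mul (isOneParam_expMap φ y)
  rw [← map_add] at h
  simpa using (h.one_eq_expMap φ).symm

theorem expMap_zero : expMap φ 0 = 1 := by
  simpa using expMap_add φ 0 0

/-- The exponential map as a homomorphism. -/
noncomputable def expHom : 𝔤 →+ Additive G where
  toFun x := Additive.ofMul (expMap φ x)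
  map_zero' := by rw [expMap_zero]; rfl
  map_add' x y := by rw [expMap_add]; rfl

theorem expMap_sum {ι : Type*} (s : Finset ι) (f : ι → 𝔤) :
    expMap φ (∑ i ∈ s, f i) = ∏ i ∈ s, expMap φ (f i) :=
  congrArg Additive.toMul (map_sum (expHom φ) f s)

theorem expMap_sub (x y : 𝔤) : expMap φ (x - y) = expMap φ x / expMap φ y :=
  congrArg Additive.toMul (map_sub (expHom φ) x y)

theorem expMap_zsmul (n : ℤ) (x : 𝔤) : expMap φ (n • x) = expMap φ x ^ n :=
  congrArg Additive.toMul (map_zsmul (expHom φ) n x)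

include φ in
theorem finiteDimensional_of_lieAlgebra : FiniteDimensional ℝ 𝔤 :=
  LinearEquiv.finiteDimensional (show E ≃ₗ[ℝ] 𝔤 from LinearEquiv.symm φ)

/-- The identification of a space with the Lie algebra, with values in the model space. -/
noncomputable def lieEquiv [FiniteDimensional ℝ 𝔤] : 𝔤 ≃L[ℝ] E :=
  LinearEquiv.toContinuousLinearEquiv (show 𝔤 ≃ₗ[ℝ] E from φ)

/-- Each factor depends on one real variable through a one-parameter subgroup, so continuity and the
derivative of the exponential map reduce to those of finitely many one-parameter subgroups. -/
theorem expMap_eq_prod {ι : Type*} [Fintype ι] (b : Module.Basis ι ℝ 𝔤) (x : 𝔤) :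
    expMap φ x = ∏ i, expMap φ (b.repr x i • b i) := by
  rw [← expMap_sum, b.sum_repr]

theorem continuous_expMap : Continuous (expMap φ) := by
  have := finiteDimensional_of_lieAlgebra φ
  have := topologicalGroup_of_lieGroup 𝓘(ℝ, E) ∞ (G := G)
  let b := Module.finBasis ℝ 𝔤
  have h : expMap φ = fun x => ∏ i, expMap φ (b.repr x i • b i) := funext (expMap_eq_prod φ b)
  rw [h]
  refine continuous_finsetProd _ fun i _ => ?_
  exact (isOneParam_expMap φ (b i)).continuous.comp (LinearMap.continuous_of_finiteDimensional (b.coord i))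

omit [FiniteDimensional ℝ E] [T2Space G] in
theorem hasMFDerivAt_finset_prod {V ι : Type*} [NormedAddCommGroup V] [NormedSpace ℝ V]
    (s : Finset ι) {f : ι → V → G} {L : ι → V →L[ℝ] E} (hf : ∀ i, f i 0 = 1)
    (h : ∀ i, HasMFDerivAt 𝓘(ℝ, V) 𝓘(ℝ, E) (f i) 0 (L i)) {M : V →L[ℝ] E}
    (hM : M = ∑ i ∈ s, L i) :
    HasMFDerivAt 𝓘(ℝ, V) 𝓘(ℝ, E) (fun x => ∏ i ∈ s, f i x) 0 M := by
  classical
  induction s using Finset.induction_on generalizing M with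
  | empty =>
    rw [hM]
    exact hasMFDerivAt_const (1 : G) (0 : V)
  | insert i s hi ih =>
    have h2 : (fun x => ∏ j ∈ insert i s, f j x) = fun x => f i x * ∏ j ∈ s, f j x :=
      funext fun x => Finset.prod_insert hi
    rw [h2, hM, Finset.sum_insert hi]
    exact hasMFDerivAt_mul_of_eq_one (hf i) (by simp [hf]) (h i) (ih rfl)

theorem hasMFDerivAt_expMap [FiniteDimensional ℝ 𝔤] :
    HasMFDerivAt 𝓘(ℝ, 𝔤) 𝓘(ℝ, E) (expMap φ) 0 (lieEquiv φ : 𝔤 →L[ℝ] E) := by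
  let b := Module.finBasis ℝ 𝔤
  let c (i) : 𝔤 →L[ℝ] ℝ := LinearMap.toContinuousLinearMap (b.coord i)
  have h : expMap φ = fun x => ∏ i, expMap φ (b.repr x i • b i) := funext (expMap_eq_prod φ b)
  have h1 : ∀ i, HasMFDerivAt 𝓘(ℝ, 𝔤) 𝓘(ℝ, E) (fun x => expMap φ (b.repr x i • b i)) 0
      ((ContinuousLinearMap.toSpanSingleton ℝ (lieEquiv φ (b i))).comp (c i)) := by
    intro i
    have h0 : HasMFDerivAt 𝓘(ℝ, 𝔤) 𝓘(ℝ, ℝ) (c i) 0 (c i) := (c i).hasFDerivAt.hasMFDerivAt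
    have h2 : ∀ r : ℝ, r = 0 → HasMFDerivAt 𝓘(ℝ, ℝ) 𝓘(ℝ, E) (fun t => expMap φ (t • b i)) r
        (ContinuousLinearMap.toSpanSingleton ℝ (lieEquiv φ (b i))) := by
      rintro r rfl; exact (isOneParam_expMap φ (b i)).2
    exact HasMFDerivAt.comp (f := c i) (0 : 𝔤) (h2 _ (map_zero _)) h0
  rw [h]
  refine hasMFDerivAt_finset_prod Finset.univ (fun i => by simp [expMap_zero]) h1 ?_
  refine ContinuousLinearMap.ext fun (x : 𝔤) => ?_
  change lieEquiv φ x = (∑ i, (ContinuousLinearMap.toSpanSingleton ℝ (lieEquiv φ (b i))).comp (c i)) x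
  conv_lhs => rw [← b.sum_repr x, map_sum]
  rw [sum_apply]
  refine Finset.sum_congr rfl fun i _ => ?_
  rw [map_smul]
  rfl

/-- The inverse function theorem in the chart at `1`: the strict derivative at `0` is the
isomorphism `lieEquiv φ`. -/
theorem map_expMap_nhds_zero : Filter.map (expMap φ) (𝓝 0) = 𝓝 1 := by
  have := finiteDimensional_of_lieAlgebra φ
  have := FiniteDimensional.complete ℝ 𝔤
  have h := hasStrictFDerivAt_of_add (expMap_add φ) (hasMFDerivAt_expMap φ)
  have h' : HasStrictFDerivAt (fun x => extChartAt 𝓘(ℝ, E) (1 : G) (expMap φ x))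
    (lieEquiv φ : 𝔤 →L[ℝ] E) 0 := h
  have h1 := h'.map_nhds_eq_of_equiv
  rw [expMap_zero] at h1
  have h2 : Filter.map (extChartAt 𝓘(ℝ, E) (1 : G)).symm
      (𝓝 (extChartAt 𝓘(ℝ, E) (1 : G) (1 : G))) = 𝓝 1 := by
    have := map_extChartAt_symm_nhdsWithin_range (I := 𝓘(ℝ, E)) (1 : G)
    simpa only [modelWithCornersSelf_coe, Set.range_id, nhdsWithin_univ] using this
  rw [← h1, Filter.map_map] at h2
  rw [← h2]
  refine Filter.map_congr ?_
  have hc : ContinuousAt (expMap φ) 0 := (continuous_expMap φ).continuousAt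
  filter_upwards [eventually_mem_chart_source (E := E) (expMap_zero φ) hc] with x hx
  exact ((extChartAt 𝓘(ℝ, E) (1 : G)).left_inv hx).symm

/-- An injective derivative isolates the solution `0`; this makes the kernel of the exponential map
discrete. -/
theorem eventually_expMap_ne_one : ∀ᶠ x in 𝓝[≠] (0 : 𝔤), expMap φ x ≠ 1 := by
  have := finiteDimensional_of_lieAlgebra φ
  have h : HasFDerivAt (fun x => extChartAt 𝓘(ℝ, E) (1 : G) (expMap φ x))
    (lieEquiv φ : 𝔤 →L[ℝ] E) 0 :=
    ((hasMFDerivAt_zero_iff (expMap_zero φ)).1 (hasMFDerivAt_expMap φ)).2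
  have h1 := h.eventually_ne (c := extChartAt 𝓘(ℝ, E) (1 : G) (1 : G))
    ⟨_, (lieEquiv φ).antilipschitz⟩
  filter_upwards [h1] with x hx h2
  exact hx (by rw [h2])

theorem isOpenMap_expMap : IsOpenMap (expMap φ) := by
  have := topologicalGroup_of_lieGroup 𝓘(ℝ, E) ∞ (G := G)
  rw [isOpenMap_iff_nhds_le]
  intro x
  have h1 : 𝓝 (expMap φ x) = Filter.map (expMap φ x * ·) (𝓝 1) := by simp
  have h2 : 𝓝 x = Filter.map (x + ·) (𝓝 0) := by simp
  rw [h1, h2, ← map_expMap_nhds_zero φ, Filter.map_map, Filter.map_map]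
  refine le_of_eq (congrArg (Filter.map · _) (funext fun y => ?_))
  simp [expMap_add]

/-- The range is an open subgroup, hence also closed, hence everything by connectedness. -/
theorem expMap_surjective [ConnectedSpace G] : Function.Surjective (expMap φ) := by
  have := topologicalGroup_of_lieGroup 𝓘(ℝ, E) ∞ (G := G)
  let H : Subgroup G := (AddMonoidHom.toMultiplicativeLeft (expHom φ)).range
  have hH : (H : Set G) = Set.range (expMap φ) := rfl
  have ho : IsOpen (H : Set G) := hH ▸ (isOpenMap_expMap φ).isOpen_range
  have hc : IsClosed (H : Set G) := H.isClosed_of_isOpen ho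
  have := IsClopen.eq_univ ⟨hc, ho⟩ ⟨1, H.one_mem⟩
  rw [hH] at this
  exact Set.range_eq_univ.1 this

end Exp

/-! ### Characters of vector spaces and of compact connected Abelian Lie groups -/

open scoped unitInterval

/-- The characters of a real topological vector space are the exponentials of the elements of the
dual space. -/
theorem exists_eq_circleExp {V : Type*} [NormedAddCommGroup V] [NormedSpace ℝ V] {f : V → Circle}
    (hf : Continuous f) (hadd : ∀ x y, f (x + y) = f x * f y) :
    ∃ ξ : V →L[ℝ] ℝ, ∀ x, f x = Circle.exp (2 * Real.pi * ξ x) := by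
  have hf0 : f 0 = 1 := by simpa using hadd 0 0
  -- The homotopy `(t, x) ↦ f (t x)` starts at the constant `1`; its lift through `Circle.exp`
  -- starting at `0` is, at time one, a continuous logarithm of `f`.
  let H : C(I × V, Circle) := ⟨fun p => f ((p.1 : ℝ) • p.2), by fun_prop⟩
  let c : C(V, ℝ) := ⟨fun _ => 0, continuous_const⟩
  have H0 : ∀ a, H (0, a) = Circle.exp (c a) := fun a => by simp [H, c, hf0]
  let F := Circle.isCoveringMap_exp.liftHomotopy H c H0
  have hF : ∀ p, Circle.exp (F p) = H p :=
    congrFun (Circle.isCoveringMap_exp.liftHomotopy_lifts H c H0)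
  have hz : F (1, 0) = 0 := by
    have h1 : (fun t : I => F (t, 0)) = fun _ => 0 := by
      refine Circle.isCoveringMap_exp.eq_of_comp_eq (by fun_prop) continuous_const ?_ 0 ?_
      · ext t
        simp [hF, H, hf0]
      · exact Circle.isCoveringMap_exp.liftHomotopy_zero H c H0 0
    exact congrFun h1 1
  have hexp : ∀ x, Circle.exp (F (1, x)) = f x := fun x => by rw [hF]; simp [H]
  have hFadd : ∀ x y, F (1, x + y) = F (1, x) + F (1, y) := by
    -- The additivity defect of the logarithm lifts the constant `1` and vanishes at `(0, 0)`, so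
    -- uniqueness of lifts on the connected space `V × V` makes it zero.
    have h1 : (fun p : V × V => F (1, p.1 + p.2) - F (1, p.1) - F (1, p.2)) = fun _ => 0 := by
      refine Circle.isCoveringMap_exp.eq_of_comp_eq (by fun_prop) continuous_const ?_ (0, 0) ?_
      · ext p
        simp [Circle.exp_sub, hexp, hadd]
      · simp [hz]
    intro x y
    have := congrFun h1 (x, y)
    simp only at this
    linarith
  let ξ : V →L[ℝ] ℝ := AddMonoidHom.toRealLinearMap
    (AddMonoidHom.mk' (fun x => F (1, x)) hFadd) (by
      change Continuous fun x => F (1, x)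
      fun_prop)
  refine ⟨(2 * Real.pi)⁻¹ • ξ, fun x => ?_⟩
  rw [smul_apply, smul_eq_mul, mul_inv_cancel_left₀ (by positivity)]
  exact (hexp x).symm

theorem circleExp_two_pi_eq_one_iff (x : ℝ) :
    Circle.exp (2 * Real.pi * x) = 1 ↔ ∃ n : ℤ, x = n := by
  rw [← Circle.exp_zero, Circle.exp_eq_exp]
  have := Real.pi_pos
  refine exists_congr fun n => ?_
  constructor
  · intro h
    have : (2 * Real.pi) * x = (2 * Real.pi) * n := by linarith
    exact mul_left_cancel₀ (by positivity) this
  · rintro rfl; ring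

theorem eq_of_circleExp_eq {V : Type*} [NormedAddCommGroup V] [NormedSpace ℝ V] {ξ η : V →L[ℝ] ℝ}
    (h : ∀ x, Circle.exp (2 * Real.pi * ξ x) = Circle.exp (2 * Real.pi * η x)) : ξ = η := by
  rw [← sub_eq_zero]
  ext x
  by_contra hx
  set a := (ξ - η) x with ha
  have hx' : a ≠ 0 := hx
  -- The difference takes only integer values, but on this multiple of `x` it equals `1/2`.
  obtain ⟨n, hn⟩ := (circleExp_two_pi_eq_one_iff ((ξ - η) ((2 * a)⁻¹ • x))).1 (by
    rw [sub_apply, mul_sub, Circle.exp_sub, h, div_self'])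
  rw [map_smul, smul_eq_mul, ← ha] at hn
  have : (2 * n : ℝ) = 1 := by rw [← hn]; field_simp
  have : (2 * n : ℤ) = 1 := by exact_mod_cast this
  omega

section Characters
variable {E : Type*} [NormedAddCommGroup E] [NormedSpace ℝ E]
  {G : Type*} [CommGroup G] [TopologicalSpace G] [ChartedSpace E G] [LieGroup 𝓘(ℝ, E) ∞ G]
  {𝔤 : Type*} [NormedAddCommGroup 𝔤] [InnerProductSpace ℝ 𝔤] [FiniteDimensional ℝ E] [T2Space G]
  (φ : 𝔤 ≃ₗ[ℝ] GroupLieAlgebra 𝓘(ℝ, E) G)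

/-- The kernel of the exponential map. -/
noncomputable def expKer : Submodule ℤ 𝔤 := AddSubgroup.toIntSubmodule (expHom φ).ker

theorem mem_expKer {x : 𝔤} : x ∈ expKer φ ↔ expMap φ x = 1 := Iff.rfl

instance : DiscreteTopology (expKer φ) := by
  refine discreteTopology_of_isOpen_singleton_zero ?_
  have h := eventually_expMap_ne_one φ
  rw [eventually_nhdsWithin_iff] at h
  rw [isOpen_singleton_iff_nhds_eq_pure, ← Filter.principal_singleton]
  refine le_antisymm ?_ (by rw [Filter.principal_singleton]; exact pure_le_nhds _)
  rw [Filter.le_principal_iff, nhds_subtype_eq_comap]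
  refine ⟨_, h, fun x hx => ?_⟩
  by_contra h0
  exact hx (by simpa using h0) x.2

theorem expMap_eq_iff {x y : 𝔤} : expMap φ x = expMap φ y ↔ x - y ∈ expKer φ := by
  rw [mem_expKer, expMap_sub, div_eq_one]

variable [ConnectedSpace G]

theorem isQuotientMap_expMap : Topology.IsQuotientMap (expMap φ) :=
  (isOpenMap_expMap φ).isQuotientMap (continuous_expMap φ) (expMap_surjective φ)

theorem exists_continuous_comp_expMap {X : Type*} [TopologicalSpace X] {f : 𝔤 → X}
    (hf : Continuous f) (h : ∀ x y, x - y ∈ expKer φ → f x = f y) :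
    ∃ F : G → X, Continuous F ∧ ∀ x, F (expMap φ x) = f x := by
  have key : ∀ x, f (Function.surjInv (expMap_surjective φ) (expMap φ x)) = f x := fun x =>
    h _ _ ((expMap_eq_iff φ).1 (Function.surjInv_eq _ _))
  refine ⟨fun g => f (Function.surjInv (expMap_surjective φ) g), ?_, key⟩
  rw [(isQuotientMap_expMap φ).continuous_iff]
  exact hf.congr fun x => (key x).symm

/-- A nonzero linear form vanishing on the span of the kernel would descend to a continuous function
on `G` that is onto `ℝ`, which compactness forbids. -/
theorem isZLattice_expKer [CompactSpace G] : IsZLattice ℝ (expKer φ) := by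
  have := finiteDimensional_of_lieAlgebra φ
  refine ⟨?_⟩
  by_contra hne
  obtain ⟨f, hf0, hf⟩ := Submodule.exists_le_ker_of_lt_top _ (lt_top_iff_ne_top.2 hne)
  obtain ⟨F, hFc, hF⟩ := exists_continuous_comp_expMap φ
    (LinearMap.continuous_of_finiteDimensional f) (fun x y hxy => by
      have : f (x - y) = 0 := hf (Submodule.subset_span hxy)
      rwa [map_sub, sub_eq_zero] at this)
  obtain ⟨C, hC⟩ := (isCompact_range hFc).bddAbove
  obtain ⟨x, hx⟩ := LinearMap.surjective hf0 (C + 1)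
  have := hC ⟨expMap φ x, rfl⟩
  rw [hF, hx] at this
  linarith

include φ in
-- If `g = exp x ≠ 1`, some coordinate of `x` in a `ℤ`-basis of the kernel lattice is not an
-- integer; `exp (2πi ·)` of that coordinate descends to a character.
theorem exists_character_ne_one [CompactSpace G] {g : G} (hg : g ≠ 1) :
    ∃ χ : G →* Circle, Continuous χ ∧ χ g ≠ 1 := by
  have := finiteDimensional_of_lieAlgebra φ
  have := isZLattice_expKer φ
  have := ZLattice.module_free ℝ (expKer φ)
  obtain ⟨x, rfl⟩ := expMap_surjective φ g
  let b₀ := Module.Free.chooseBasis ℤ (expKer φ)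
  let b := b₀.ofZLatticeBasis ℝ (expKer φ)
  obtain ⟨i, hi⟩ : ∃ i, ∀ n : ℤ, b.repr x i ≠ n := by
    by_contra! h
    choose n hn using h
    refine hg ((mem_expKer φ).1 ?_)
    rw [← b.sum_repr x]
    refine Submodule.sum_mem _ fun i _ => ?_
    rw [hn i, Int.cast_smul_eq_zsmul]
    refine Submodule.smul_mem _ _ ?_
    simp [b]
  obtain ⟨F, hFc, hF⟩ := exists_continuous_comp_expMap φ
    (f := fun x => Circle.exp (2 * Real.pi * b.coord i x)) (by
      have := LinearMap.continuous_of_finiteDimensional (b.coord i)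
      fun_prop) (fun y z hyz => by
      rw [← div_eq_one, ← Circle.exp_sub, ← mul_sub, ← map_sub, circleExp_two_pi_eq_one_iff]
      refine ⟨b₀.repr ⟨y - z, hyz⟩ i, ?_⟩
      have := b₀.ofZLatticeBasis_repr_apply ℝ (expKer φ) ⟨y - z, hyz⟩ i
      simpa using this)
  refine ⟨MonoidHom.mk' F fun g h => ?_, hFc, ?_⟩
  · obtain ⟨y, rfl⟩ := expMap_surjective φ g
    obtain ⟨z, rfl⟩ := expMap_surjective φ h
    rw [← expMap_add, hF, hF, hF, map_add, mul_add, Circle.exp_add]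
  · intro h
    have h' : F (expMap φ x) = 1 := h
    rw [hF, circleExp_two_pi_eq_one_iff] at h'
    obtain ⟨n, hn⟩ := h'
    exact hi n hn

end Characters

/-! ### The closed ball as a manifold with boundary -/

theorem nonempty_chartedSpace_of_forall {H X : Type*} [TopologicalSpace H] [TopologicalSpace X]
    (h : ∀ x : X, ∃ e : OpenPartialHomeomorph X H, x ∈ e.source) : Nonempty (ChartedSpace H X) := by
  choose e he using h
  exact ⟨{ atlas := Set.univ
           chartAt := e
           mem_chart_source := he
           chart_mem_atlas := fun _ => Set.mem_univ _ }⟩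

section Ball
variable {V : Type*} [NormedAddCommGroup V] [InnerProductSpace ℝ V]

open scoped RealInnerProductSpace

theorem norm_sq_inv_smul_smul {y : V} (hy : y ≠ 0) :
    (‖(‖y‖ ^ 2)⁻¹ • y‖ ^ 2)⁻¹ • (‖y‖ ^ 2)⁻¹ • y = y := by
  have : ‖y‖ ≠ 0 := norm_ne_zero_iff.2 hy
  rw [norm_smul, smul_smul, norm_inv, norm_pow, norm_norm]
  convert! one_smul ℝ y using 2
  field_simp

theorem norm_sub_sq_le_iff {e y : V} (he : ‖e‖ = 1) :
    ‖y - e‖ ≤ 1 ↔ ‖y‖ ^ 2 ≤ 2 * ⟪y, e⟫ := by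
  rw [← sq_le_one_iff₀ (norm_nonneg _), norm_sub_sq_real, he]
  constructor <;> intro h <;> linarith

/-- With `norm_sub_sq_le_iff`: inversion at the origin takes the unit sphere around `e`, which
passes through the origin, to the hyperplane `⟪w, e⟫ = 1/2`. This explains the shift by `e / 2` in
`ballInversion`. -/
theorem le_inner_inversion_iff {e y : V} (hy : y ≠ 0) :
    1 / 2 ≤ ⟪(‖y‖ ^ 2)⁻¹ • y, e⟫ ↔ ‖y‖ ^ 2 ≤ 2 * ⟪y, e⟫ := by
  have : 0 < ‖y‖ ^ 2 := by positivity
  rw [real_inner_smul_left, inv_mul_eq_div, div_le_div_iff₀ two_pos this, one_mul, mul_comm ⟪y, e⟫]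

theorem ne_zero_of_half_le_inner {e w : V} (h : 1 / 2 ≤ ⟪w, e⟫) : w ≠ 0 := by
  rintro rfl
  rw [inner_zero_left] at h
  linarith

/-- The inversion centered at a boundary point maps the closed unit ball without that point
onto a half-space. -/
noncomputable def ballInversion {e : V} (he : ‖e‖ = 1) :
    {x : V // ‖x‖ ≤ 1 ∧ x ≠ -e} ≃ₜ {z : V // 0 ≤ ⟪z, e⟫} where
  toFun x := ⟨(‖x.1 + e‖ ^ 2)⁻¹ • (x.1 + e) - (1 / 2 : ℝ) • e, by
    have h0 : x.1 + e ≠ 0 := fun h => x.2.2 (eq_neg_of_add_eq_zero_left h)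
    have h1 := (norm_sub_sq_le_iff he (y := x.1 + e)).1 (by simpa using x.2.1)
    rw [← le_inner_inversion_iff h0] at h1
    rw [inner_sub_left, real_inner_smul_left e, real_inner_self_eq_norm_sq, he]
    linarith⟩
  invFun z := ⟨(‖z.1 + (1 / 2 : ℝ) • e‖ ^ 2)⁻¹ • (z.1 + (1 / 2 : ℝ) • e) - e, by
    have h1 : 1 / 2 ≤ ⟪z.1 + (1 / 2 : ℝ) • e, e⟫ := by
      rw [inner_add_left, real_inner_smul_left e, real_inner_self_eq_norm_sq, he]
      linarith [z.2]
    have h0 := ne_zero_of_half_le_inner h1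
    have h2 : (‖z.1 + (1 / 2 : ℝ) • e‖ ^ 2)⁻¹ • (z.1 + (1 / 2 : ℝ) • e) ≠ 0 :=
      smul_ne_zero (by positivity) h0
    refine ⟨?_, fun h => h2 (by simpa using h)⟩
    rw [norm_sub_sq_le_iff he, ← le_inner_inversion_iff h2, norm_sq_inv_smul_smul h0]
    exact h1⟩
  left_inv x := by
    have h0 : x.1 + e ≠ 0 := fun h => x.2.2 (eq_neg_of_add_eq_zero_left h)
    ext1
    simp only [sub_add_cancel]
    rw [norm_sq_inv_smul_smul h0, add_sub_cancel_right]
  right_inv z := by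
    have h1 : 1 / 2 ≤ ⟪z.1 + (1 / 2 : ℝ) • e, e⟫ := by
      rw [inner_add_left, real_inner_smul_left e, real_inner_self_eq_norm_sq, he]
      linarith [z.2]
    have h0 := ne_zero_of_half_le_inner h1
    ext1
    simp only [sub_add_cancel]
    rw [norm_sq_inv_smul_smul h0, add_sub_cancel_right]
  continuous_toFun := by
    refine Continuous.subtype_mk ?_ _
    refine (Continuous.smul (Continuous.inv₀ (by fun_prop) fun x => ?_) (by fun_prop)).sub
      continuous_const
    have h0 : x.1 + e ≠ 0 := fun h => x.2.2 (eq_neg_of_add_eq_zero_left h)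
    positivity
  continuous_invFun := by
    refine Continuous.subtype_mk ?_ _
    refine (Continuous.smul (Continuous.inv₀ (by fun_prop) fun z => ?_) (by fun_prop)).sub
      continuous_const
    have h1 : 1 / 2 ≤ ⟪z.1 + (1 / 2 : ℝ) • e, e⟫ := by
      rw [inner_add_left, real_inner_smul_left e, real_inner_self_eq_norm_sq, he]
      linarith [z.2]
    have h0 := ne_zero_of_half_le_inner h1
    positivity

end Ball

section HalfSpace
variable {d : ℕ} [NeZero d]

/-- The closed unit ball is a manifold with boundary. -/
theorem nonempty_chartedSpace_closedBall :
    Nonempty (ChartedSpace (EuclideanHalfSpace d)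
      (Metric.closedBall (0 : EuclideanSpace ℝ (Fin d)) 1)) := by
  let e : EuclideanSpace ℝ (Fin d) := EuclideanSpace.single 0 1
  have he : ‖e‖ = 1 := by simp [e]
  let B := Metric.closedBall (0 : EuclideanSpace ℝ (Fin d)) 1
  let U : TopologicalSpace.Opens B := ⟨{x | x.1 ≠ -e}, by
    exact isOpen_ne.preimage continuous_subtype_val⟩
  let h1 : U ≃ₜ {x : EuclideanSpace ℝ (Fin d) // ‖x‖ ≤ 1 ∧ x ≠ -e} :=
    { toFun := fun x => ⟨x.1.1, mem_closedBall_zero_iff.1 x.1.2, x.2⟩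
      invFun := fun x => ⟨⟨x.1, mem_closedBall_zero_iff.2 x.2.1⟩, x.2.2⟩
      left_inv := fun x => rfl
      right_inv := fun x => rfl
      continuous_toFun := by fun_prop
      continuous_invFun := by fun_prop }
  have h2 : ∀ z : EuclideanSpace ℝ (Fin d), 0 ≤ inner ℝ z e ↔ 0 ≤ z 0 := fun z => by
    simp [e, EuclideanSpace.inner_single_right]
  let h3 : {z : EuclideanSpace ℝ (Fin d) // 0 ≤ inner ℝ z e} ≃ₜ EuclideanHalfSpace d :=
    (Homeomorph.refl _).subtype h2
  let hU : U ≃ₜ EuclideanHalfSpace d := (h1.trans (ballInversion he)).trans h3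
  have x0 : B := ⟨0, by simp [B]⟩
  have hne : Nonempty U := ⟨⟨⟨0, by simp [B]⟩, fun h => by
    have : e = 0 := by simpa using h.symm
    simp [this] at he⟩⟩
  let c : OpenPartialHomeomorph B (EuclideanHalfSpace d) :=
    (U.openPartialHomeomorphSubtypeCoe hne).symm.trans hU.toOpenPartialHomeomorph
  have hc : ∀ x : B, x.1 ≠ -e → x ∈ c.source := fun x hx => by
    simp [c]
    exact hx
  let n : B ≃ₜ B := (Homeomorph.neg _).subtype fun x => by simp [B]
  refine nonempty_chartedSpace_of_forall fun x => ?_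
  -- The inversion chart misses only `-e`; composing it with the antipodal map covers that point.
  by_cases hx : x.1 = -e
  · refine ⟨n.toOpenPartialHomeomorph.trans c, ?_⟩
    have h4 : n x ∈ c.source := hc _ fun h => by
      have h5 : -x.1 = -e := h
      rw [hx] at h5
      rw [neg_neg] at h5
      have h6 : e 0 = -e 0 := congrArg (· 0) h5
      simp [e] at h6
      linarith
    simpa using h4
  · exact ⟨c, hc x hx⟩

end HalfSpace

/-! ### Boxes as a cofinal family of regions -/

section Box
variable {d : ℕ}

variable (d) in
/-- The cells contained in the box `[-N, N]^d`. -/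
noncomputable def boxCells (N : ℕ) : Finset (Cell d) :=
  ((Fintype.piFinset fun _ => Finset.Icc (-(N : ℤ)) N) ×ˢ Finset.univ).filter
    fun c => ∀ i ∈ c.2, c.1 i + 1 ≤ N

theorem mem_boxCells {N : ℕ} {c : Cell d} :
    c ∈ boxCells d N ↔ (∀ i, -(N : ℤ) ≤ c.1 i ∧ c.1 i ≤ N) ∧ ∀ i ∈ c.2, c.1 i + 1 ≤ N := by
  simp [boxCells, Fintype.mem_piFinset]

theorem realization_boxCells {N : ℕ} (hN : 1 ≤ N) :
    realization (boxCells d N) = {y : EuclideanSpace ℝ (Fin d) | ∀ i, -(N : ℝ) ≤ y i ∧ y i ≤ N} := by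
  ext y
  simp only [realization, Set.mem_iUnion, exists_prop, Set.mem_ofPred_eq, mem_boxCells]
  constructor
  · rintro ⟨c, ⟨hc, hc'⟩, hy⟩ i
    have h1 : (-(N : ℝ)) ≤ c.1 i := by exact_mod_cast (hc i).1
    refine ⟨h1.trans (hy i).1, (hy i).2.trans ?_⟩
    split_ifs with hi
    · have h2 : ((c.1 i + 1 : ℤ) : ℝ) ≤ (N : ℤ) := Int.cast_le.2 (hc' i hi)
      simpa using h2
    · have h2 : ((c.1 i : ℤ) : ℝ) ≤ (N : ℤ) := Int.cast_le.2 (hc i).2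
      simpa using h2
  · intro hy
    -- The minimum with `N - 1` serves the faces `y i = N`, which belong to the last cube rather
    -- than to one starting at `N`.
    refine ⟨(fun i => min ⌊y i⌋ (N - 1), Finset.univ), ⟨fun i => ⟨?_, ?_⟩, fun i _ => ?_⟩, fun i => ?_⟩
    · exact le_min (Int.le_floor.2 (by exact_mod_cast (hy i).1)) (by omega)
    · exact (min_le_right _ _).trans (by omega)
    · have := min_le_right ⌊y i⌋ ((N : ℤ) - 1)
      simp only
      omega
    · simp only [Finset.mem_univ, if_true]
      refine ⟨le_trans (by exact_mod_cast min_le_left _ _) (Int.floor_le (y i)), ?_⟩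
      rcases min_cases ⌊y i⌋ ((N : ℤ) - 1) with h | h
      · rw [h.1]; exact (Int.lt_floor_add_one (y i)).le
      · rw [h.1]; push_cast; linarith [(hy i).2]

theorem convex_box (N : ℝ) : Convex ℝ {y : EuclideanSpace ℝ (Fin d) | ∀ i, -N ≤ y i ∧ y i ≤ N} := by
  intro x hx y hy a b ha hb hab i
  have h1 := hx i
  have h2 := hy i
  simp only [PiLp.add_apply, PiLp.smul_apply, smul_eq_mul]
  have hN : N = a * N + b * N := by rw [← add_mul, hab, one_mul]
  constructor <;> nlinarith

theorem isClosed_box (N : ℝ) :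
    IsClosed {y : EuclideanSpace ℝ (Fin d) | ∀ i, -N ≤ y i ∧ y i ≤ N} := by
  simp only [Set.ofPred_forall, Set.ofPred_and]
  exact isClosed_iInter fun i => (isClosed_le continuous_const (by fun_prop)).inter
    (isClosed_le (by fun_prop) continuous_const)

theorem closedBall_subset_box (N : ℝ) :
    Metric.closedBall 0 N ⊆ {y : EuclideanSpace ℝ (Fin d) | ∀ i, -N ≤ y i ∧ y i ≤ N} := by
  intro y hy i
  exact abs_le.1 ((PiLp.norm_apply_le y i).trans (mem_closedBall_zero_iff.1 hy))

theorem isBounded_box (N : ℝ) :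
    Bornology.IsBounded {y : EuclideanSpace ℝ (Fin d) | ∀ i, -N ≤ y i ∧ y i ≤ N} := by
  have h : Bornology.IsBounded (Set.Icc (fun _ => -N : Fin d → ℝ) (fun _ => N)) :=
    Metric.isBounded_Icc _ _
  have := (EuclideanSpace.equiv (Fin d) ℝ).symm.lipschitz.isBounded_image h
  refine this.subset fun y hy => ⟨y.ofLp, ⟨fun i => (hy i).1, fun i => (hy i).2⟩, rfl⟩

variable [NeZero d]

/-- The box `[-N, N]^d` as a region. -/
noncomputable def boxRegion (N : ℕ) (hN : 1 ≤ N) : Region d where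
  cells := boxCells d N
  upper_mem c hc i hi := by
    rw [mem_boxCells] at hc ⊢
    refine ⟨fun j => ?_, fun j hj => ?_⟩
    · have h1 := hc.1 j
      by_cases hij : j = i
      · subst hij
        have := hc.2 j hi
        simp [Cell.upper]
        omega
      · simpa [Cell.upper, hij] using h1
    · have hij := (Finset.mem_erase.1 hj).1
      simpa [Cell.upper, hij] using hc.2 j (Finset.mem_of_mem_erase hj)
  lower_mem c hc i hi := by
    rw [mem_boxCells] at hc ⊢
    exact ⟨hc.1, fun j hj => hc.2 j (Finset.mem_of_mem_erase hj)⟩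
  contractible := by
    rw [realization_boxCells hN]
    exact (convex_box _).contractibleSpace ⟨0, fun i => by simp⟩
  manifold := by
    rw [realization_boxCells hN]
    have hN' : (0 : ℝ) < N := by exact_mod_cast hN
    -- A bounded convex set with nonempty interior has closure homeomorphic to the closed ball; here
    -- `1 ≤ N` provides the interior.
    obtain ⟨h, -, h2, -⟩ := exists_homeomorph_image_interior_closure_frontier_eq_unitBall
      (convex_box (d := d) N) ⟨0, mem_interior_iff_mem_nhds.2 (Filter.mem_of_superset
        (Metric.closedBall_mem_nhds 0 hN') (closedBall_subset_box _))⟩ (isBounded_box _)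
    rw [(isClosed_box _).closure_eq] at h2
    exact nonempty_chartedSpace_of_homeomorph
      ((h.image _).trans (Homeomorph.setCongr h2)).symm nonempty_chartedSpace_closedBall

/-- Large boxes contain any finite set of cells. Hence the index set is directed, so that limits
along it make sense. -/
theorem exists_region_superset (S : Finset (Cell d)) : ∃ K : Region d, S ⊆ K.cells := by
  let N := S.sup (fun c => Finset.univ.sup fun i => (c.1 i).natAbs) + 1
  refine ⟨boxRegion N (by omega), fun c hc => mem_boxCells.2 ?_⟩
  have h : ∀ i, (c.1 i).natAbs + 1 ≤ N := fun i => by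
    refine Nat.succ_le_succ ?_
    exact (Finset.le_sup (f := fun i => (c.1 i).natAbs) (Finset.mem_univ i)).trans
      (Finset.le_sup (f := fun c : Cell d => Finset.univ.sup fun i => (c.1 i).natAbs) hc)
  refine ⟨fun i => ?_, fun i _ => ?_⟩ <;> have := h i <;> omega

instance : Nonempty (Region d) := ⟨(exists_region_superset ∅).choose⟩

instance : IsDirectedOrder (Region d) := ⟨fun K K' => by
  obtain ⟨L, hL⟩ := exists_region_superset (K.cells ∪ K'.cells)
  exact ⟨L, Finset.subset_union_left.trans hL, Finset.subset_union_right.trans hL⟩⟩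

/-- Countability keeps the product over all regions second countable, which makes the limit group
Polish. -/
instance : Countable (Region d) :=
  Function.Injective.countable (f := Region.cells) fun K K' h => by
    cases K; cases K'; congr

end Box

/-! ### Path products of edge values in a cube -/

section Cube
variable {d : ℕ}

/-- The indicator vector of a set of directions. -/
def ind (T : Finset (Fin d)) (i : Fin d) : ℤ := if i ∈ T then 1 else 0

theorem ind_empty : ind (∅ : Finset (Fin d)) = 0 := by
  ext i; simp [ind]

theorem ind_union {S T : Finset (Fin d)} (h : Disjoint S T) : ind (S ∪ T) = ind S + ind T := by
  ext i
  have : i ∈ S → i ∉ T := fun hi => Finset.disjoint_left.1 h hi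
  by_cases h1 : i ∈ S <;> by_cases h2 : i ∈ T <;> simp_all [ind]

theorem ind_insert {T : Finset (Fin d)} {j : Fin d} (h : j ∉ T) :
    ind (insert j T) = ind T + Pi.single j 1 := by
  ext i
  by_cases h1 : i = j
  · subst h1; simp [ind, h]
  · simp [ind, h1]

/-- The product of the edge values `f` along the monotone path from `x` to `x + ind T`. -/
def pathProd {A : Type*} [CommGroup A] (f : Cell d → A) (x : Fin d → ℤ) (T : Finset (Fin d)) : A :=
  ∏ i ∈ T, f (x + ind (T.filter (· < i)), {i})

variable {A : Type*} [CommGroup A] {f : Cell d → A}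

theorem pathProd_empty (x : Fin d → ℤ) : pathProd f x ∅ = 1 := by simp [pathProd]

theorem pathProd_insert_max (x : Fin d → ℤ) {T : Finset (Fin d)} {m : Fin d}
    (h : ∀ i ∈ T, i < m) : pathProd f x (insert m T) = pathProd f x T * f (x + ind T, {m}) := by
  have hm : m ∉ T := fun hm => lt_irrefl _ (h m hm)
  rw [pathProd, Finset.prod_insert hm, mul_comm]
  congr 1
  · refine Finset.prod_congr rfl fun i hi => ?_
    rw [Finset.filter_insert, if_neg (h i hi).not_gt]
  · rw [Finset.filter_insert, if_neg (lt_irrefl _), Finset.filter_true_of_mem h]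

/-- The direction `j` can always be taken last, whatever its place in the coordinate order: it is
exchanged with each larger direction through one flat plaquette, by induction on the maximum of `T`.
-/
theorem pathProd_insert (x : Fin d → ℤ) {T : Finset (Fin d)} {j : Fin d} (hj : j ∉ T)
    (hf : ∀ U m, U ⊆ T → m ∈ T → m ∉ U → f (x + ind U + Pi.single j 1, {m}) * f (x + ind U, {j}) =
      f (x + ind U, {m}) * f (x + ind U + Pi.single m 1, {j})) :
    pathProd f x (insert j T) = pathProd f x T * f (x + ind T, {j}) := by
  induction T using Finset.induction_on_max with
  | empty => exact pathProd_insert_max x (by simp)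
  | insert m T hT ih =>
    have hm : m ∉ T := fun hm => lt_irrefl _ (hT m hm)
    have hjm : j ≠ m := fun h => hj (h ▸ Finset.mem_insert_self _ _)
    have hjT : j ∉ T := fun h => hj (Finset.mem_insert_of_mem h)
    rcases lt_or_gt_of_ne hjm with h | h
    · have ih' := ih hjT fun U n hU hn hnU =>
        hf U n (hU.trans (Finset.subset_insert _ _)) (Finset.mem_insert_of_mem hn) hnU
      have h1 : ∀ i ∈ insert j T, i < m := by
        intro i hi
        rcases Finset.mem_insert.1 hi with rfl | hi
        exacts [h, hT i hi]
      rw [Finset.insert_comm, pathProd_insert_max x h1, ih', pathProd_insert_max x hT,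
        ind_insert hjT, ind_insert hm, mul_assoc, mul_assoc, ← add_assoc, ← add_assoc,
        ← hf T m (Finset.subset_insert _ _) (Finset.mem_insert_self _ _) hm, mul_comm (f _)]
    · refine pathProd_insert_max x fun i hi => ?_
      rcases Finset.mem_insert.1 hi with rfl | hi
      exacts [h, (hT i hi).trans h]

/-- The product of edge values along a path from `v` to `w`, for vertices of a common cube. -/
def transition (f : Cell d → A) (v w : Fin d → ℤ) : A :=
  (pathProd f (v ⊓ w) (Finset.univ.filter fun i => w i < v i))⁻¹ *
    pathProd f (v ⊓ w) (Finset.univ.filter fun i => v i < w i)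

theorem transition_self (v : Fin d → ℤ) : transition f v v = 1 := by simp [transition]

end Cube

/-! ### Closed 1-cochains on a contractible complex are exact -/

section Region
variable {d : ℕ} [NeZero d] {K : Region d}

theorem Region.face_mem {x : Fin d → ℤ} {S T : Finset (Fin d)} (h : (x, S) ∈ K.cells)
    (hT : T ⊆ S) : (x + ind T, S \ T) ∈ K.cells := by
  induction T using Finset.induction_on with
  | empty => simpa [ind_empty] using h
  | insert j T hj ih =>
    have hjS : j ∈ S := hT (Finset.mem_insert_self _ _)
    have := K.upper_mem _ (ih ((Finset.subset_insert _ _).trans hT)) j (by simp [hj, hjS])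
    rw [ind_insert hj, ← add_assoc, Finset.sdiff_insert]
    exact this

theorem Region.subset_mem {x : Fin d → ℤ} {S T : Finset (Fin d)} (h : (x, S) ∈ K.cells)
    (hT : T ⊆ S) : (x, T) ∈ K.cells := by
  have key : ∀ R : Finset (Fin d), R ⊆ S → (x, S \ R) ∈ K.cells := by
    intro R hR
    induction R using Finset.induction_on with
    | empty => simpa using h
    | insert j R hj ih =>
      have := K.lower_mem _ (ih ((Finset.subset_insert _ _).trans hR)) j
        (by simp [hj, hR (Finset.mem_insert_self _ _)])
      rw [Finset.sdiff_insert]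
      exact this
  have := key (S \ T) Finset.sdiff_subset
  rwa [Finset.sdiff_sdiff_eq_self hT] at this

variable {A : Type*} [CommGroup A] {f : Cochain K 1 A}

theorem plaquette_of_cobG_eq_one (hf : cobG A K 1 f = 1) {x : Fin d → ℤ} {i j : Fin d}
    (hij : i ≠ j) (hx : (x, {i, j}) ∈ K.cells) :
    extendOne f (x + Pi.single i 1, {j}) * extendOne f (x, {i}) =
      extendOne f (x, {j}) * extendOne f (x + Pi.single j 1, {i}) := by
  wlog hlt : i < j generalizing i j
  · have := this hij.symm (Finset.pair_comm i j ▸ hx) (lt_of_le_of_ne (not_lt.1 hlt) hij.symm)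
    rw [mul_comm, ← this, mul_comm]
  have hc : ((x, {i, j}) : Cell d) ∈ K.cells.filter (·.2.card = 2) :=
    Finset.mem_filter.2 ⟨hx, Finset.card_pair hij⟩
  have h := congrFun hf ⟨_, hc⟩
  rw [cobG_apply_eq] at h
  have e1 : ({i, j} : Finset (Fin d)).erase i = {j} := by
    ext a; simp; grind
  have e2 : ({i, j} : Finset (Fin d)).erase j = {i} := by
    ext a; simp; grind
  have s1 : ({i, j} : Finset (Fin d)).filter (· < i) = ∅ := by
    ext a; simp; grind
  have s2 : ({i, j} : Finset (Fin d)).filter (· < j) = {i} := by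
    ext a; simp; grind
  rw [Finset.prod_pair hij] at h
  simp only [Cell.upper, Cell.lower, Cell.sign, e1, e2, s1, s2, Finset.card_empty,
    Finset.card_singleton, pow_zero, pow_one, zpow_one, zpow_neg, Pi.one_apply] at h
  rw [mul_inv_eq_one, div_eq_div_iff_mul_eq_mul] at h
  rw [h, mul_comm]

theorem pathProd_insert_of_mem (hf : cobG A K 1 f = 1) {x : Fin d → ℤ} {S T : Finset (Fin d)}
    (hS : (x, S) ∈ K.cells) {j : Fin d} (hT : insert j T ⊆ S) (hj : j ∉ T) :
    pathProd (extendOne f) x (insert j T) =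
      pathProd (extendOne f) x T * extendOne f (x + ind T, {j}) := by
  refine pathProd_insert x hj fun U m hU hm hmU => ?_
  have hjm : j ≠ m := fun h => hj (h ▸ hm)
  refine plaquette_of_cobG_eq_one hf hjm (Region.subset_mem (Region.face_mem hS
    ((hU.trans (Finset.subset_insert _ _)).trans hT)) ?_)
  intro i hi
  rcases Finset.mem_insert.1 hi with rfl | hi
  · exact Finset.mem_sdiff.2 ⟨hT (Finset.mem_insert_self _ _), fun h => hj (hU h)⟩
  · rw [Finset.mem_singleton] at hi
    subst hi
    exact Finset.mem_sdiff.2 ⟨hT (Finset.mem_insert_of_mem hm), hmU⟩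

theorem pathProd_add_ind (hf : cobG A K 1 f = 1) {x : Fin d → ℤ} {S R T : Finset (Fin d)}
    (hS : (x, S) ∈ K.cells) (hR : R ⊆ S) (hT : T ⊆ S) (hRT : Disjoint R T) :
    pathProd (extendOne f) (x + ind R) T =
      (pathProd (extendOne f) x R)⁻¹ * pathProd (extendOne f) x (R ∪ T) := by
  induction T using Finset.induction_on with
  | empty => simp [pathProd_empty]
  | insert j T hj ih =>
    have hjR : j ∉ R := fun h => Finset.disjoint_left.1 hRT h (Finset.mem_insert_self _ _)
    have hRT' : Disjoint R T := hRT.mono_right (Finset.subset_insert _ _)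
    have hTS : T ⊆ S := (Finset.subset_insert _ _).trans hT
    have h1 : insert j T ⊆ S \ R := fun i hi =>
      Finset.mem_sdiff.2 ⟨hT hi, fun h => Finset.disjoint_left.1 hRT h hi⟩
    have h2 : insert j (R ∪ T) ⊆ S :=
      Finset.insert_subset (hT (Finset.mem_insert_self _ _)) (Finset.union_subset hR hTS)
    rw [pathProd_insert_of_mem hf (Region.face_mem hS hR) h1 hj, ih hTS hRT', Finset.union_insert,
      pathProd_insert_of_mem hf hS h2 (by simp [hj, hjR]), ind_union hRT', add_assoc, mul_assoc]

/-- For vertices of one cell, the path through the meet may be replaced by the path through the base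
vertex `x`. The transitions then form a coboundary, and the cocycle identity telescopes. -/
theorem transition_eq (hf : cobG A K 1 f = 1) {x : Fin d → ℤ} {S R T : Finset (Fin d)}
    (hS : (x, S) ∈ K.cells) (hR : R ⊆ S) (hT : T ⊆ S) :
    transition (extendOne f) (x + ind R) (x + ind T) =
      (pathProd (extendOne f) x R)⁻¹ * pathProd (extendOne f) x T := by
  have h0 : (x + ind R) ⊓ (x + ind T) = x + ind (R ∩ T) := by
    ext i
    by_cases h1 : i ∈ R <;> by_cases h2 : i ∈ T <;> simp [ind, h1, h2]
  have h1 : (Finset.univ.filter fun i => (x + ind T) i < (x + ind R) i) = R \ T := by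
    ext i
    by_cases h1 : i ∈ R <;> by_cases h2 : i ∈ T <;> simp [ind, h1, h2]
  have h2 : (Finset.univ.filter fun i => (x + ind R) i < (x + ind T) i) = T \ R := by
    ext i
    by_cases h1 : i ∈ R <;> by_cases h2 : i ∈ T <;> simp [ind, h1, h2]
  have h3 : R ∩ T ∪ R \ T = R := by ext i; simp; tauto
  have h4 : R ∩ T ∪ T \ R = T := by ext i; simp; tauto
  have h5 : R ∩ T ⊆ S := Finset.inter_subset_left.trans hR
  rw [transition, h0, h1, h2, pathProd_add_ind hf hS h5 (Finset.sdiff_subset.trans hR),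
    pathProd_add_ind hf hS h5 (Finset.sdiff_subset.trans hT), h3, h4]
  · simp
  · exact Finset.disjoint_left.2 fun i hi hi' => (Finset.mem_sdiff.1 hi').2 (Finset.mem_inter.1 hi).1
  · exact Finset.disjoint_left.2 fun i hi hi' => (Finset.mem_sdiff.1 hi').2 (Finset.mem_inter.1 hi).2

omit [NeZero d] in
-- The open cube of radius `1` around a lattice point `v` meets a closed cell only if `v` is a
-- vertex of that cell.
theorem exists_eq_add_ind {c : Cell d} {y : EuclideanSpace ℝ (Fin d)} (hy : y ∈ c.cube)
    {v : Fin d → ℤ} (hv : ∀ i, |y i - v i| < 1) : ∃ T ⊆ c.2, v = c.1 + ind T := by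
  have h : ∀ i, (v i = c.1 i ∧ i ∉ c.2) ∨ (i ∈ c.2 ∧ (v i = c.1 i ∨ v i = c.1 i + 1)) := by
    intro i
    have h1 := hy i
    have h2 := abs_lt.1 (hv i)
    by_cases hi : i ∈ c.2
    · rw [if_pos hi] at h1
      have h3 : ((c.1 i - 1 : ℤ) : ℝ) < v i := by push_cast; linarith
      have h4 : ((v i : ℤ) : ℝ) < ((c.1 i + 2 : ℤ) : ℝ) := by push_cast; linarith
      have h5 := Int.cast_lt.1 h3
      have h6 := Int.cast_lt.1 h4
      exact Or.inr ⟨hi, by omega⟩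
    · rw [if_neg hi] at h1
      have h3 : ((c.1 i - 1 : ℤ) : ℝ) < v i := by push_cast; linarith
      have h4 : ((v i : ℤ) : ℝ) < ((c.1 i + 1 : ℤ) : ℝ) := by push_cast; linarith
      have h5 := Int.cast_lt.1 h3
      have h6 := Int.cast_lt.1 h4
      exact Or.inl ⟨by omega, hi⟩
  refine ⟨Finset.univ.filter fun i => v i = c.1 i + 1, fun i hi => ?_, ?_⟩
  · have h1 := (Finset.mem_filter.1 hi).2
    rcases h i with h2 | h2
    · omega
    · exact h2.1
  · ext i
    have := h i
    simp only [Pi.add_apply, ind, Finset.mem_filter, Finset.mem_univ, true_and]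
    split_ifs <;> omega

/-- The flat `A`-bundle over the realization of `K` defined by a closed cochain: its sections are
the primitives of the cochain. -/
noncomputable def primitiveBundle [TopologicalSpace A] [DiscreteTopology A] (hf : cobG A K 1 f = 1) :
    FiberBundleCore (Fin d → ℤ) (realization K.cells) A where
  baseSet v := {y | ∀ i, |y.1 i - v i| < 1}
  isOpen_baseSet v := by
    simp only [Set.ofPred_forall]
    exact isOpen_iInter_of_finite fun i => isOpen_lt (by fun_prop) continuous_const
  indexAt y := fun i => ⌊y.1 i⌋
  mem_baseSet_at y i := by
    rw [abs_lt]
    constructor <;> linarith [Int.floor_le (y.1 i), Int.lt_floor_add_one (y.1 i)]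
  coordChange v w _ a := a * transition (extendOne f) v w
  coordChange_self v _ _ a := by rw [transition_self, mul_one]
  continuousOn_coordChange v w :=
    (Continuous.comp (g := fun a : A => a * transition (extendOne f) v w)
      continuous_of_discreteTopology continuous_snd).continuousOn
  coordChange_comp u v w y hy a := by
    -- A cell of `K` containing `y` has all three lattice points among its vertices.
    obtain ⟨c, hc, hyc⟩ := Set.mem_iUnion₂.1 y.2
    obtain ⟨R, hR, rfl⟩ := exists_eq_add_ind hyc hy.1.1
    obtain ⟨S, hS, rfl⟩ := exists_eq_add_ind hyc hy.1.2
    obtain ⟨T, hT, rfl⟩ := exists_eq_add_ind hyc hy.2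
    rw [transition_eq hf hc hR hS, transition_eq hf hc hS hT, transition_eq hf hc hR hT, mul_assoc,
      mul_assoc, mul_inv_cancel_left]

/-- With discrete fibre the bundle is a covering. Lifting the reversed contraction, from the
constant map at `x₀` to the identity, gives at time one a lift of the identity. -/
theorem exists_section_of_contractible {X F : Type*} [TopologicalSpace X] [ContractibleSpace X]
    [Nonempty F] {ι : Type*} [TopologicalSpace F] [DiscreteTopology F] (Z : FiberBundleCore ι X F) :
    ∃ s : C(X, Z.TotalSpace), ∀ x, Z.proj (s x) = x := by
  obtain ⟨x₀, ⟨H⟩⟩ := id_nullhomotopic X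
  have cov : IsCoveringMap Z.proj := FiberBundle.isCoveringMap (F := F) (E := Z.Fiber)
  let a₀ : F := Classical.arbitrary F
  let s₀ : C(X, Z.TotalSpace) := .const X ⟨x₀, a₀⟩
  let L := cov.liftHomotopy H.symm.toContinuousMap s₀ fun a => H.symm.apply_zero a
  refine ⟨⟨fun x => L (1, x), by fun_prop⟩, fun x => ?_⟩
  have := congrFun (cov.liftHomotopy_lifts H.symm.toContinuousMap s₀
    fun a => H.symm.apply_zero a) (1, x)
  exact this.trans (H.symm.apply_one x)

/-- The point of the realization of `K` on an edge. -/
def edgePoint {x : Fin d → ℤ} {i : Fin d} (h : (x, {i}) ∈ K.cells) (t : I) :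
    realization K.cells :=
  ⟨WithLp.toLp 2 fun j => x j + if j = i then (t : ℝ) else 0, Set.mem_iUnion₂.2 ⟨_, h, fun j => by
    by_cases hj : j = i <;> simp [hj, t.2.1, t.2.2]⟩⟩

theorem continuous_edgePoint {x : Fin d → ℤ} {i : Fin d} (h : (x, {i}) ∈ K.cells) :
    Continuous (edgePoint h) := by
  refine Continuous.subtype_mk ?_ _
  refine (PiLp.continuous_toLp 2 _).comp (continuous_pi fun j => ?_)
  by_cases hj : j = i
  · simp only [hj, if_true]; fun_prop
  · simp only [hj, if_false]; fun_prop

/-- The vertex of the realization of `K` given by a `0`-cell. -/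
def vertexPoint {x : Fin d → ℤ} (h : (x, ∅) ∈ K.cells) : realization K.cells :=
  ⟨WithLp.toLp 2 fun j => (x j : ℝ), Set.mem_iUnion₂.2 ⟨_, h, fun j => by simp⟩⟩

/-- A section of the flat bundle is a primitive: its value at a vertex is read in the trivialization
centred there. Along an edge, each endpoint's trivialization is constant up to the midpoint, where
the change of trivialization is the edge value of `f`. -/
theorem exists_primitive (hf : cobG A K 1 f = 1) : ∃ g, cobG A K 0 g = f := by
  -- The discrete topology is an auxiliary device, unrelated to any topology of the coefficients; it
  -- turns continuous local sections into locally constant ones.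
  let _ : TopologicalSpace A := ⊥
  have : DiscreteTopology A := ⟨rfl⟩
  have := K.contractible
  let Z := primitiveBundle hf
  obtain ⟨s, hs⟩ := exists_section_of_contractible Z
  let loc (v : Fin d → ℤ) (y : realization K.cells) : A := (Z.localTriv v (s y)).2
  have hloc : ∀ v, ContinuousOn (loc v) (Z.baseSet v) := fun v => by
    refine continuous_snd.comp_continuousOn
      ((Z.localTriv v).continuousOn.comp s.continuous.continuousOn fun y hy => ?_)
    rw [(Z.localTriv v).mem_source]
    change Z.proj (s y) ∈ Z.baseSet v
    rwa [hs]
  have hchange : ∀ v w y, y ∈ Z.baseSet v → y ∈ Z.baseSet w →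
      loc w y = loc v y * transition (extendOne f) v w := by
    intro v w y hv hw
    have key : ∀ p : Z.TotalSpace, p.1 ∈ Z.baseSet v → p.1 ∈ Z.baseSet w →
        (Z.localTriv w p).2 = (Z.localTriv v p).2 * transition (extendOne f) v w :=
      fun p hv hw => (Z.coordChange_comp (Z.indexAt p.1) v w p.1
        ⟨⟨Z.mem_baseSet_at p.1, hv⟩, hw⟩ p.2).symm
    have h1 : (s y).1 = y := hs y
    exact key (s y) (by rwa [h1]) (by rwa [h1])
  have hvert : ∀ c : KCell K 0, (c.1.1, (∅ : Finset (Fin d))) ∈ K.cells := fun c => by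
    have h := Finset.mem_filter.1 c.2
    rw [← Finset.card_eq_zero.1 h.2]
    exact h.1
  have hedge : ∀ (x : Fin d → ℤ) (i : Fin d) (h : (x, {i}) ∈ K.cells) (v : Fin d → ℤ) (t₀ : I)
      (ht : ∀ t ∈ Set.uIcc t₀ ⟨1 / 2, by norm_num, by norm_num⟩, edgePoint h t ∈ Z.baseSet v),
      loc v (edgePoint h t₀) = loc v (edgePoint h ⟨1 / 2, by norm_num, by norm_num⟩) := by
    intro x i h v t₀ ht
    have hc : ContinuousOn (fun t => loc v (edgePoint h t)) _ :=
      (hloc v).comp (continuous_edgePoint h).continuousOn ht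
    exact isPreconnected_uIcc.constant hc Set.left_mem_uIcc Set.right_mem_uIcc
  refine ⟨fun c => loc c.1.1 (vertexPoint (hvert c)), ?_⟩
  ext c
  obtain ⟨⟨x, S⟩, hS⟩ := c
  have hS' := Finset.mem_filter.1 hS
  obtain ⟨i, rfl⟩ := Finset.card_eq_one.1 hS'.2
  have h := hS'.1
  have hx : (x, (∅ : Finset (Fin d))) ∈ K.cells := by simpa [Cell.lower] using K.lower_mem _ h i (by simp)
  have hx' : (x + Pi.single i 1, (∅ : Finset (Fin d))) ∈ K.cells := by
    simpa [Cell.upper] using K.upper_mem _ h i (by simp)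
  have e0 : vertexPoint hx = edgePoint h 0 := by
    ext j
    simp [vertexPoint, edgePoint]
  have e1 : vertexPoint hx' = edgePoint h 1 := by
    ext j
    by_cases hj : j = i
    · subst hj; simp [vertexPoint, edgePoint]
    · simp [vertexPoint, edgePoint, hj]
  let m : I := ⟨1 / 2, by norm_num, by norm_num⟩
  have b0 : ∀ t : I, (t : ℝ) < 1 → edgePoint h t ∈ Z.baseSet x := fun t ht j => by
    by_cases hj : j = i
    · simpa [edgePoint, hj, abs_of_nonneg t.2.1] using ht
    · simp [edgePoint, hj]
  have b1 : ∀ t : I, 0 < (t : ℝ) → edgePoint h t ∈ Z.baseSet (x + Pi.single i 1) := fun t ht j => by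
    by_cases hj : j = i
    · subst hj
      have h1 : (edgePoint h t).1 j = x j + (t : ℝ) := by simp [edgePoint]
      have h2 : (((x + Pi.single j 1 : Fin d → ℤ) j : ℤ) : ℝ) = x j + 1 := by simp
      rw [h1, h2, abs_lt]
      constructor <;> linarith [t.2.2]
    · simp [edgePoint, hj]
  have h0 : loc x (vertexPoint hx) = loc x (edgePoint h m) := by
    rw [e0]
    refine hedge x i h x 0 fun t ht => b0 t ?_
    rw [Set.uIcc_of_le unitInterval.nonneg'] at ht
    have : (t : ℝ) ≤ 1 / 2 := ht.2
    linarith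
  have h1 : loc (x + Pi.single i 1) (vertexPoint hx') = loc (x + Pi.single i 1) (edgePoint h m) := by
    rw [e1]
    refine hedge x i h _ 1 fun t ht => b1 t ?_
    rw [Set.uIcc_of_ge unitInterval.le_one'] at ht
    have : 1 / 2 ≤ (t : ℝ) := ht.1
    linarith
  have h2 := hchange x (x + Pi.single i 1) (edgePoint h m) (b0 m (by norm_num [m]))
    (b1 m (by norm_num [m]))
  have h3 := transition_eq hf h (Finset.empty_subset _) (Finset.Subset.refl {i})
  have h4 : ind {i} = Pi.single i 1 := by
    have := ind_insert (Finset.notMem_empty i)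
    rwa [ind_empty, zero_add] at this
  have h5 : pathProd (extendOne f) x {i} = extendOne f (x, {i}) := by
    simp [pathProd, Finset.filter_singleton, ind_empty]
  rw [ind_empty, add_zero, h4, pathProd_empty, inv_one, one_mul, h5] at h3
  have h6 : extendOne f (x, {i}) = f ⟨(x, {i}), hS⟩ := dif_pos hS
  rw [h3, ← h0, ← h1, h6] at h2
  have h7 : Cell.sign ((x, {i}) : Cell d) i = 1 := by
    simp [Cell.sign, Finset.filter_singleton]
  change ∏ j : ({i} : Finset (Fin d)), _ = _
  rw [Fintype.prod_subsingleton _ ⟨i, Finset.mem_singleton_self i⟩]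
  change (loc (x + Pi.single i 1) (vertexPoint hx') / loc x (vertexPoint hx)) ^
    Cell.sign ((x, {i}) : Cell d) i = _
  rw [h7, zpow_one, h2, mul_div_cancel_left]

end Region

/-! ### Compact limit groups and the limit coboundary -/

theorem isClosed_projLimGroup {ι : Type*} [Preorder ι] (A : ι → Type*) [∀ i, Group (A i)]
    [∀ i, TopologicalSpace (A i)] [∀ i, T2Space (A i)] (Ψ : ∀ i j, i ≤ j → A j →* A i)
    (hΨ : ∀ i j h, Continuous (Ψ i j h)) : IsClosed (projLimGroup A Ψ : Set (∀ i, A i)) := by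
  have : (projLimGroup A Ψ : Set (∀ i, A i)) =
      ⋂ i, ⋂ j, ⋂ h : i ≤ j, {x | Ψ i j h (x j) = x i} := by
    ext x; simp [projLimGroup]
  rw [this]
  refine isClosed_iInter fun i => isClosed_iInter fun j => isClosed_iInter fun h => ?_
  exact isClosed_eq ((hΨ i j h).comp (continuous_apply j)) (continuous_apply i)

section Limit
variable {d : ℕ} [NeZero d] {G : Type*} [CommGroup G]

theorem cobBar_injective (K : Region d) : Function.Injective (cobBar G K) := by
  rw [injective_iff_map_eq_one]
  intro x hx
  induction x using QuotientGroup.induction_on with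
  | H f =>
    have h : cobG G K 1 f = 1 := congrArg Subtype.val hx
    obtain ⟨g, hg⟩ := exists_primitive h
    exact (QuotientGroup.eq_one_iff f).2 ⟨g, hg⟩

theorem cobBar_surjective (K : Region d) : Function.Surjective (cobBar G K) := by
  rintro ⟨_, f, rfl⟩
  exact ⟨(f : gaugeQuot G K), rfl⟩

theorem cobBar_gaugeRes (K K' : Region d) (h : K ≤ K') (x : gaugeQuot G K') :
    cobBar G K (gaugeRes G K K' h x) = exactRes G K K' h (cobBar G K' x) := by
  induction x using QuotientGroup.induction_on with
  | H f => rfl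

theorem cobLim_bijective : Function.Bijective (cobLim d G) := by
  constructor
  · intro x y h
    refine Subtype.ext (funext fun K => cobBar_injective K ?_)
    exact congrFun (congrArg Subtype.val h) K
  · intro y
    choose x hx using fun K => cobBar_surjective K (y.1 K)
    refine ⟨⟨x, fun K K' h => cobBar_injective K ?_⟩, Subtype.ext (funext hx)⟩
    rw [cobBar_gaugeRes, hx, hx]
    exact y.2 K K' h

variable [TopologicalSpace G] [IsTopologicalGroup G]

theorem continuous_cobG (K : Region d) (k : ℕ) : Continuous (cobG G K k) :=
  continuous_pi fun c => continuous_finsetProd _ fun i _ => by fun_prop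

omit [IsTopologicalGroup G] in
theorem continuous_restrG {K K' : Region d} (h : K ≤ K') (k : ℕ) : Continuous (restrG G h k) :=
  continuous_pi fun _ => continuous_apply _

theorem continuous_cobBar (K : Region d) : Continuous (cobBar G K) := by
  refine isQuotientMap_quotient_mk'.continuous_iff.2 ?_
  exact (continuous_cobG K 1).subtype_mk _

omit [IsTopologicalGroup G] in
theorem continuous_gaugeRes (K K' : Region d) (h : K ≤ K') : Continuous (gaugeRes G K K' h) := by
  refine isQuotientMap_quotient_mk'.continuous_iff.2 ?_
  exact QuotientGroup.continuous_mk.comp (continuous_restrG h 1)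

omit [IsTopologicalGroup G] in
theorem continuous_exactRes (K K' : Region d) (h : K ≤ K') : Continuous (exactRes G K K' h) :=
  ((continuous_restrG h 2).comp continuous_subtype_val).subtype_mk _

theorem continuous_cobLim : Continuous (cobLim d G) :=
  (continuous_pi fun K => (continuous_cobBar K).comp
    ((continuous_apply K).comp continuous_subtype_val)).subtype_mk _

variable [T2Space G] [CompactSpace G]

instance (K : Region d) : CompactSpace (exactG G K) :=
  isCompact_iff_compactSpace.1 (isCompact_range (continuous_cobG K 1))

instance : CompactSpace (exactLim d G) :=
  isCompact_iff_compactSpace.1 (isClosed_projLimGroup _ _ continuous_exactRes).isCompact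

instance : CompactSpace (gaugeLim d G) := by
  have : ∀ K : Region d, T2Space (gaugeQuot G K) := fun K => by
    have : IsClosed ((cobG G K 0).range : Set (Cochain K 1 G)) :=
      (isCompact_range (continuous_cobG K 0)).isClosed
    infer_instance
  exact isCompact_iff_compactSpace.1 (isClosed_projLimGroup _ _ continuous_gaugeRes).isCompact

theorem isHomeomorph_cobLim : IsHomeomorph (cobLim d G) :=
  isHomeomorph_iff_continuous_bijective.2 ⟨continuous_cobLim, cobLim_bijective⟩

end Limit

/-- The characters of a projective limit of compact groups with surjective projections factor
through the projections. -/
theorem exists_character_eq_comp {ι : Type*} [Preorder ι] [IsDirectedOrder ι] [Nonempty ι]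
    {A : ι → Type*} [∀ i, CommGroup (A i)] [∀ i, TopologicalSpace (A i)] [∀ i, T2Space (A i)]
    {Ψ : ∀ i j, i ≤ j → A j →* A i} [CompactSpace (projLimGroup A Ψ)]
    (hsurj : ∀ i, Function.Surjective fun x : projLimGroup A Ψ => x.1 i)
    (χ : PontryaginDual (projLimGroup A Ψ)) :
    ∃ (i : ι) (χ' : PontryaginDual (A i)), ∀ x : projLimGroup A Ψ, χ x = χ' (x.1 i) := by
  -- The circle has no small subgroups: a point all of whose powers stay in this arc is `1`.
  have hU : χ ⁻¹' Circle.centeredArc (Real.pi / 2) ∈ 𝓝 1 := by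
    refine (map_continuous χ).continuousAt.preimage_mem_nhds
      ((Circle.isOpen_centeredArc _).mem_nhds ?_)
    rw [map_one, Circle.mem_centeredArc (by linarith [Real.pi_pos])]
    simp [Real.pi_pos]
  rw [nhds_subtype_eq_comap, nhds_pi] at hU
  obtain ⟨V, hV, hVU⟩ := hU
  obtain ⟨S, hS, t, ht, htV⟩ := Filter.mem_pi.1 hV
  obtain ⟨i, hi⟩ := hS.bddAbove
  let π : projLimGroup A Ψ →* A i :=
    { toFun := fun x => x.1 i, map_one' := rfl, map_mul' := fun _ _ => rfl }
  -- The neighbourhood only constrains coordinates in the finite set `S`, and `i` bounds `S`; so all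
  -- powers of an element with trivial `i`-th coordinate lie in it.
  have hker : π.ker ≤ (χ : projLimGroup A Ψ →* Circle).ker := by
    intro x hx
    refine Circle.eq_one_of_forall_pow_mem_centeredArc_pi_div_two fun n _ => ?_
    have : χ (x ^ n) ∈ Circle.centeredArc (Real.pi / 2) := by
      refine hVU (htV fun j hj => ?_)
      have h1 : (x ^ n).1 j = 1 := by
        rw [← (x ^ n).2 j i (hi hj)]
        have : (x ^ n).1 i = 1 := π.ker.pow_mem hx n
        rw [this, map_one]
      rw [h1]
      exact mem_of_mem_nhds (ht j)
    rwa [map_pow] at this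
  have hcont : Continuous π := (continuous_apply i).comp continuous_subtype_val
  have hq : Topology.IsQuotientMap π := hcont.isClosedMap.isQuotientMap hcont (hsurj i)
  let χ' := π.liftOfRightInverse _ (Function.rightInverse_surjInv (hsurj i))
    ⟨(χ : projLimGroup A Ψ →* Circle), hker⟩
  have hχ' : ∀ x, χ' (π x) = χ x :=
    π.liftOfRightInverse_comp_apply _ (Function.rightInverse_surjInv (hsurj i)) ⟨_, hker⟩
  refine ⟨i, ⟨χ', ?_⟩, fun x => (hχ' x).symm⟩
  refine hq.continuous_iff.2 ?_
  exact (map_continuous χ).congr fun x => (hχ' x).symm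

/-! ### The limit exponential map and dual vectors -/

section Dual
variable {d : ℕ} [NeZero d]

/-- A primitive on `K` extended by `1` to the whole lattice has a coboundary on every region, and
these are compatible. -/
theorem surjective_exactLim_apply {G : Type*} [CommGroup G] (K : Region d) :
    Function.Surjective fun x : exactLim d G => x.1 K := by
  rintro ⟨_, f, rfl⟩
  refine ⟨⟨fun K' => ⟨_, fun c => extendOne f c.1, rfl⟩, fun _ _ _ => rfl⟩, ?_⟩
  refine Subtype.ext (congrArg (cobG G K 1) (funext fun c => ?_))
  exact dif_pos c.2

variable {E : Type*} [NormedAddCommGroup E] [NormedSpace ℝ E] [FiniteDimensional ℝ E]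
  {G : Type*} [CommGroup G] [TopologicalSpace G] [ChartedSpace E G] [LieGroup 𝓘(ℝ, E) ∞ G]
  [T2Space G] {𝔤 : Type*} [NormedAddCommGroup 𝔤] [InnerProductSpace ℝ 𝔤]
  (φ : 𝔤 ≃ₗ[ℝ] GroupLieAlgebra 𝓘(ℝ, E) G)

/-- The exponential map of the group of exact 2-cochains. -/
noncomputable def exactExp (K : Region d) (v : exactLie 𝔤 K) : exactG G K :=
  ⟨fun p => expMap φ (v.1 p), by
    obtain ⟨_, w, rfl⟩ := v
    refine ⟨fun c => expMap φ (w c), funext fun p => ?_⟩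
    change ∏ i : p.1.2, (expMap φ (w (p.upper i)) / expMap φ (w (p.lower i))) ^ p.1.sign i =
      expMap φ (∑ i : p.1.2, p.1.sign i • (w (p.upper i) - w (p.lower i)))
    simp only [expMap_sum, expMap_zsmul, expMap_sub]⟩

theorem exactExp_add (K : Region d) (v w : exactLie 𝔤 K) :
    exactExp φ K (v + w) = exactExp φ K v * exactExp φ K w :=
  Subtype.ext (funext fun p => expMap_add φ (v.1 p) (w.1 p))

theorem continuous_exactExp (K : Region d) : Continuous (exactExp (G := G) φ K) :=
  (continuous_pi fun p => (continuous_expMap φ).comp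
    ((PiLp.continuous_apply 2 _ p).comp continuous_subtype_val)).subtype_mk _

theorem exists_isDualVector (K : Region d) (χ : PontryaginDual (exactG G K)) :
    ∃ ξ, IsDualVector φ K χ ξ := by
  obtain ⟨ξ, hξ⟩ := exists_eq_circleExp ((map_continuous χ).comp (continuous_exactExp φ K))
    (fun x y => by simp only [Function.comp_apply, exactExp_add, map_mul])
  refine ⟨ξ, fun v γ hγ t => ?_⟩
  have : γ t = exactExp φ K (t • v) :=
    Subtype.ext (funext fun p => (hγ p).eq_expMap φ t)
  rw [this]
  simpa using hξ (t • v)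

theorem apply_exactExp (K : Region d) (χ : PontryaginDual (exactG G K)) (v : exactLie 𝔤 K) :
    χ (exactExp φ K v) = Circle.exp (2 * Real.pi * dualVector φ K χ v) := by
  have h : IsDualVector φ K χ (dualVector φ K χ) := by
    rw [dualVector, dif_pos (exists_isDualVector φ K χ)]
    exact (exists_isDualVector φ K χ).choose_spec
  simpa using h v (fun t => exactExp φ K (t • v)) (fun p => isOneParam_expMap φ (v.1 p)) 1

/-- The exponential map of the limit of the groups of exact 2-cochains. -/
noncomputable def limExp (h : exactLieLim d 𝔤) : exactLim d G :=
  ⟨fun K => exactExp φ K (h.1 K), fun K K' hK => by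
    change exactRes G K K' hK (exactExp φ K' (h.1 K')) = exactExp φ K (h.1 K)
    rw [← h.2 K K' hK]
    rfl⟩

theorem continuous_limExp : Continuous (limExp (d := d) (G := G) φ) :=
  (continuous_pi fun K => (continuous_exactExp φ K).comp
    (projLimHilb.proj _ (exactLieRes 𝔤) K).continuous).subtype_mk _

/-- Whichever level the choice in `limJ` picks, the identity holds at that level; thus the chosen
functional need not be known. -/
theorem apply_limExp [CompactSpace G] (χ : PontryaginDual (exactLim d G)) (h : exactLieLim d 𝔤) :
    χ (limExp φ h) = Circle.exp (2 * Real.pi * dualVectorLim d φ χ h) := by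
  have := topologicalGroup_of_lieGroup 𝓘(ℝ, E) ∞ (G := G)
  obtain ⟨K, χ', hχ⟩ := exists_character_eq_comp (A := fun K : Region d => exactG G K)
    (Ψ := exactRes G) surjective_exactLim_apply χ
  have hex : ∃ ξ, IsLimJ (fun K : Region d => exactG G K) (exactRes G)
      (fun K : Region d => exactLie 𝔤 K) (exactLieRes 𝔤) (dualVector φ) χ ξ :=
    ⟨_, K, χ', hχ, rfl⟩
  obtain ⟨L, ψ, hψ, hξ⟩ := hex.choose_spec
  have h1 : dualVectorLim d φ χ = hex.choose := by
    rw [dualVectorLim, limJ, dif_pos hex]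
  rw [h1, hξ, hψ]
  exact apply_exactExp φ L ψ (h.1 L)

/-- The exponential identity determines the functional, since a real functional with integer values
is zero. -/
theorem eq_dualVectorLim [CompactSpace G] {χ : PontryaginDual (exactLim d G)}
    {ξ : exactLieLim d 𝔤 →L[ℝ] ℝ}
    (h : ∀ x, χ (limExp φ x) = Circle.exp (2 * Real.pi * ξ x)) : dualVectorLim d φ χ = ξ :=
  eq_of_circleExp_eq fun x => by rw [← apply_limExp, h]

end Dual

theorem polishSpace_of_compactSpace (X : Type*) [TopologicalSpace X] [CompactSpace X] [T2Space X]
    [SecondCountableTopology X] : PolishSpace X := by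
  let := TopologicalSpace.metrizableSpaceMetric X
  infer_instance

/-! ### Heat kernel measures: uniqueness and existence -/

section Fourier
variable {A : Type*} [CommGroup A] [TopologicalSpace A] [CompactSpace A]
  [MeasurableSpace A] [BorelSpace A]

/-- The complex conjugate of a character of a compact group, as a continuous function. -/
noncomputable def conjCharacter (χ : PontryaginDual A) : BoundedContinuousFunction A ℂ :=
  BoundedContinuousFunction.mkOfCompact
    ⟨fun x => (starRingEnd ℂ) (χ x : ℂ),
      Complex.continuous_conj.comp (continuous_subtype_val.comp (map_continuous χ))⟩

omit [MeasurableSpace A] [BorelSpace A] in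
theorem conjCharacter_apply (χ : PontryaginDual A) (x : A) :
    conjCharacter χ x = (starRingEnd ℂ) (χ x : ℂ) := rfl

/-- The trigonometric polynomials on a compact group. -/
noncomputable def trigPoly (A : Type*) [CommGroup A] [TopologicalSpace A] [CompactSpace A] :
    StarSubalgebra ℂ (BoundedContinuousFunction A ℂ) :=
  let M := Submodule.span ℂ (Set.range (conjCharacter (A := A)))
  { M.toSubalgebra
      (Submodule.subset_span ⟨1, by ext x; simp [conjCharacter_apply]⟩)
      (fun x y hx hy => by
        have h := Submodule.mul_mem_mul hx hy
        rw [Submodule.span_mul_span] at h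
        refine Submodule.span_mono ?_ h
        rintro _ ⟨_, ⟨χ, rfl⟩, _, ⟨ψ, rfl⟩, rfl⟩
        refine ⟨χ * ψ, ?_⟩
        ext x
        change (starRingEnd ℂ) ((χ x * ψ x : Circle) : ℂ) = _
        simp [conjCharacter_apply]) with
    star_mem' := fun {f} hf => by
      change f ∈ M at hf
      change star f ∈ M
      induction hf using Submodule.span_induction with
      | mem f hf =>
        obtain ⟨χ, rfl⟩ := hf
        refine Submodule.subset_span ⟨χ⁻¹, ?_⟩
        ext x
        change (starRingEnd ℂ) (((χ x)⁻¹ : Circle) : ℂ) = (starRingEnd ℂ) ((starRingEnd ℂ) (χ x : ℂ))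
        rw [Circle.coe_inv_eq_conj]
      | zero => simp
      | add f g _ _ hf hg => rw [star_add]; exact M.add_mem hf hg
      | smul a f _ hf => rw [star_smul]; exact M.smul_mem _ hf }

/-- Measures on a compact group with enough characters are determined by their Fourier
transforms. -/
theorem measure_ext_of_characters [PolishSpace A]
    (hsep : ∀ x y : A, x ≠ y → ∃ χ : PontryaginDual A, χ x ≠ χ y) {μ ν : Measure A}
    [IsFiniteMeasure μ] [IsFiniteMeasure ν]
    (h : ∀ χ : PontryaginDual A,
      ∫ x, (starRingEnd ℂ) (χ x : ℂ) ∂μ = ∫ x, (starRingEnd ℂ) (χ x : ℂ) ∂ν) : μ = ν := by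
  refine ext_of_forall_mem_subalgebra_integral_eq_of_polish (𝕜 := ℂ) (A := trigPoly A) ?_ ?_
  · intro x y hxy
    obtain ⟨χ, hχ⟩ := hsep x y hxy
    refine ⟨_, ⟨_, ⟨conjCharacter χ, Submodule.subset_span ⟨χ, rfl⟩, rfl⟩, rfl⟩, fun he => hχ ?_⟩
    exact Subtype.ext ((starRingEnd ℂ).injective he)
  · intro g hg
    change g ∈ Submodule.span ℂ (Set.range (conjCharacter (A := A))) at hg
    induction hg using Submodule.span_induction with
    | mem f hf =>
      obtain ⟨χ, rfl⟩ := hf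
      exact h χ
    | zero => simp
    | add f g _ _ hf hg =>
      simp only [BoundedContinuousFunction.add_apply]
      rw [integral_add (f.integrable μ) (g.integrable μ), integral_add (f.integrable ν)
        (g.integrable ν), hf, hg]
    | smul a f _ hf =>
      simp only [BoundedContinuousFunction.smul_apply, integral_smul, hf]

omit [CompactSpace A] in
/-- The pushforward of a Gaussian measure under an exponential map is a heat kernel measure. -/
theorem exists_isHeatKernelMeasure_of_finiteDimensional {F : Type*} [NormedAddCommGroup F]
    [InnerProductSpace ℝ F] [FiniteDimensional ℝ F] {e : F → A} (he : Continuous e)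
    {J : PontryaginDual A → F →L[ℝ] ℝ}
    (hJ : ∀ χ x, χ (e x) = Circle.exp (2 * Real.pi * J χ x)) {β : ℝ} (hβ : 0 ≤ β) :
    ∃ μ, IsHeatKernelMeasure J β μ := by
  borelize F
  have hm : Measurable fun x : F => e (Real.sqrt (2 * β) • x) := by
    exact (he.comp (continuous_const_smul _)).measurable
  -- The standard Gaussian has Fourier transform `exp (-‖·‖² / 2)`; evaluated at `-2π √(2β) J χ` it
  -- is `exp (-4π² β ‖J χ‖²)`. The sign comes from the conjugate.
  refine ⟨(ProbabilityTheory.stdGaussian F).map fun x => e (Real.sqrt (2 * β) • x),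
    Measure.isProbabilityMeasure_map hm.aemeasurable, fun χ => ?_⟩
  rw [integral_map hm.aemeasurable (by
    exact (Complex.continuous_conj.comp
      (continuous_subtype_val.comp (map_continuous χ))).measurable.aestronglyMeasurable)]
  have h := ProbabilityTheory.charFunDual_stdGaussian (-(2 * Real.pi * Real.sqrt (2 * β)) • J χ)
  rw [charFunDual_apply] at h
  convert h using 2
  · ext x
    rw [hJ, Circle.coe_exp, ← Complex.exp_conj]
    congr 1
    simp [map_ofNat]
    ring
  · rw [norm_smul, Complex.ofReal_exp]
    congr 1
    rw [norm_neg, Real.norm_of_nonneg (by positivity)]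
    push_cast
    have : ((Real.sqrt (2 * β) : ℝ) : ℂ) ^ 2 = 2 * β := by
      exact_mod_cast Real.sq_sqrt (by positivity : 0 ≤ 2 * β)
    rw [mul_pow, mul_pow, this]
    ring

/-- The norms of the restrictions of a functional to finite-dimensional subspaces converge to its
norm. -/
theorem tendsto_norm_restrict_span {H : Type*} [NormedAddCommGroup H] [NormedSpace ℝ H]
    (ξ : H →L[ℝ] ℝ) :
    Filter.Tendsto (fun s : Finset H => ‖ξ.comp (Submodule.span ℝ (s : Set H)).subtypeL‖)
      Filter.atTop (𝓝 ‖ξ‖) := by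
  refine tendsto_order.2 ⟨fun a ha => ?_, fun a ha => Filter.Eventually.of_forall fun s => ?_⟩
  · rcases lt_or_ge a 0 with h0 | h0
    · exact Filter.Eventually.of_forall fun s => h0.trans_le
        (ContinuousLinearMap.opNorm_nonneg _)
    -- A vector witnessing `‖ξ‖ > a` does so on every span that contains it.
    obtain ⟨x, hx⟩ : ∃ x, a * ‖x‖ < ‖ξ x‖ := by
      by_contra! h
      exact absurd (ξ.opNorm_le_bound h0 h) (not_le.2 ha)
    filter_upwards [Filter.eventually_ge_atTop {x}] with s hs
    have hxs : x ∈ Submodule.span ℝ (s : Set H) :=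
      Submodule.subset_span (hs (Finset.mem_singleton_self x))
    have := (ξ.comp (Submodule.span ℝ (s : Set H)).subtypeL).le_opNorm ⟨x, hxs⟩
    by_contra! hle
    exact absurd (hx.trans_le (this.trans (mul_le_mul_of_nonneg_right hle (norm_nonneg x))))
      (lt_irrefl _)
  · refine lt_of_le_of_lt (ContinuousLinearMap.opNorm_le_bound _ (norm_nonneg _) fun x => ?_) ha
    exact ξ.le_opNorm x.1

/-- Heat kernel measures exist on compact groups with an exponential map from a (possibly
infinite-dimensional) inner product space. -/
theorem exists_isHeatKernelMeasure [T2Space A] {H : Type*} [NormedAddCommGroup H]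
    [NormedSpace ℝ H]
    (hpar : ∀ x y : H, ‖x + y‖ * ‖x + y‖ + ‖x - y‖ * ‖x - y‖ = 2 * (‖x‖ * ‖x‖ + ‖y‖ * ‖y‖))
    {e : H → A} (he : Continuous e) {J : PontryaginDual A → H →L[ℝ] ℝ}
    (hJ : ∀ χ x, χ (e x) = Circle.exp (2 * Real.pi * J χ x)) {β : ℝ} (hβ : 0 ≤ β) :
    ∃ μ, IsHeatKernelMeasure J β μ := by
  have key : ∀ s : Finset H, ∃ μ, IsHeatKernelMeasure
      (fun χ => (J χ).comp (Submodule.span ℝ (s : Set H)).subtypeL) β μ := by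
    intro s
    -- Only the finite-dimensional spans need an inner product, and the parallelogram law recovers
    -- it from the given norm.
    let : InnerProductSpace ℝ (Submodule.span ℝ (s : Set H)) :=
      InnerProductSpace.ofNorm ℝ fun x y => hpar x.1 y.1
    have : FiniteDimensional ℝ (Submodule.span ℝ (s : Set H)) :=
      FiniteDimensional.span_finset ℝ s
    exact exists_isHeatKernelMeasure_of_finiteDimensional
      (J := fun χ => (J χ).comp (Submodule.span ℝ (s : Set H)).subtypeL)
      (he.comp continuous_subtype_val) (fun χ x => hJ χ x.1) hβ
  choose m hm using key
  let P : Finset H → ProbabilityMeasure A := fun s => ⟨m s, (hm s).1⟩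
  let U : Ultrafilter (Finset H) := Ultrafilter.of Filter.atTop
  have hU : (U : Filter (Finset H)) ≤ Filter.atTop := Ultrafilter.of_le _
  -- Probability measures on a compact Hausdorff space are weakly compact, so the ultrafilter
  -- converges.
  have hlim : Filter.Tendsto P U (𝓝 (U.map P).lim) := (U.map P).le_nhds_lim
  refine ⟨(U.map P).lim, inferInstance, fun χ => ?_⟩
  have h1 := (ProbabilityMeasure.tendsto_iff_forall_integral_rclike_tendsto ℂ).1 hlim
    (conjCharacter χ)
  refine tendsto_nhds_unique h1 ?_
  have h2 : ∀ s, ∫ x, conjCharacter χ x ∂(P s : Measure A) = _ := fun s => (hm s).2 χ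
  simp only [h2]
  exact ((Complex.continuous_ofReal.comp Real.continuous_exp).tendsto _).comp
    ((((tendsto_norm_restrict_span (J χ)).mono_left hU).pow 2).const_mul _)

end Fourier

/-! ### The parallelogram law in the limit Hilbert space -/

section HilbertLimit
variable {ι : Type*} [Preorder ι] [IsDirectedOrder ι] [Nonempty ι] {V : ι → Type*}
  [∀ i, NormedAddCommGroup (V i)] [∀ i, InnerProductSpace ℝ (V i)]
  {Φ : ∀ i j, i ≤ j → V j →ₗ[ℝ] V i}

omit [IsDirectedOrder ι] [Nonempty ι] in
theorem tendsto_norm_projLimHilb (hΦ : ∀ i j h x, ‖Φ i j h x‖ ≤ ‖x‖) (x : projLimHilb V Φ) :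
    Filter.Tendsto (fun i => ‖x.1 i‖) Filter.atTop (𝓝 ‖x‖) := by
  have h : ‖x‖ = ⨆ i, ‖x.1 i‖ := lp.norm_eq_ciSup x.1
  rw [h]
  refine tendsto_atTop_ciSup (fun i j hij => ?_) (memℓp_infty_iff.1 (lp.memℓp x.1))
  change ‖x.1 i‖ ≤ ‖x.1 j‖
  rw [← x.2 i j hij]
  exact hΦ i j hij _

/-- The supremum norm is the limit of the level norms, monotone because the maps are contractions;
the identity holds at each level and passes to the limit. -/
theorem parallelogram_projLimHilb (hΦ : ∀ i j h x, ‖Φ i j h x‖ ≤ ‖x‖) (x y : projLimHilb V Φ) :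
    ‖x + y‖ * ‖x + y‖ + ‖x - y‖ * ‖x - y‖ = 2 * (‖x‖ * ‖x‖ + ‖y‖ * ‖y‖) := by
  have h := tendsto_norm_projLimHilb hΦ
  refine tendsto_nhds_unique (((h (x + y)).mul (h (x + y))).add ((h (x - y)).mul (h (x - y)))) ?_
  refine ((((h x).mul (h x)).add ((h y).mul (h y))).const_mul 2).congr fun i => ?_
  simp only [← pow_two]
  exact (parallelogram_law_with_norm ℝ (x.1 i) (y.1 i)).symm

end HilbertLimit

/-- Composing with an injection only drops summands of the squared norm; this serves both
restriction and translation. -/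
theorem norm_toLp_comp_le {ι κ V : Type*} [Fintype ι] [Fintype κ] [NormedAddCommGroup V]
    {s : ι → κ} (hs : Function.Injective s) (f : PiLp 2 fun _ : κ => V) :
    ‖(WithLp.toLp 2 fun i => f (s i) : PiLp 2 fun _ : ι => V)‖ ≤ ‖f‖ := by
  refine le_of_sq_le_sq ?_ (norm_nonneg _)
  rw [PiLp.norm_sq_eq_of_L2, PiLp.norm_sq_eq_of_L2]
  have h := Finset.sum_le_univ_sum_of_nonneg (f := fun j => ‖f j‖ ^ 2)
    (s := Finset.univ.map ⟨s, hs⟩) fun j => by positivity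
  rwa [Finset.sum_map] at h

theorem norm_comp_le_of_forall_norm_le {H : Type*} [NormedAddCommGroup H] [NormedSpace ℝ H]
    {T : H →L[ℝ] H} (hT : ∀ x, ‖T x‖ ≤ ‖x‖) (ξ : H →L[ℝ] ℝ) : ‖ξ.comp T‖ ≤ ‖ξ‖ :=
  ContinuousLinearMap.opNorm_le_bound _ (ContinuousLinearMap.opNorm_nonneg _) fun x =>
    (ξ.le_opNorm (T x)).trans
      (mul_le_mul_of_nonneg_left (hT x) (ContinuousLinearMap.opNorm_nonneg _))

/-! ### Lattice translations on the limits -/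

section Translation
variable {d : ℕ} [NeZero d]

theorem KCell.incl_injective {K K' : Region d} {k : ℕ} (h : K ≤ K') :
    Function.Injective (KCell.incl (k := k) h) :=
  fun x y hxy => Subtype.ext (show x.1 = y.1 from congrArg (fun c => c.1) hxy)

theorem KCell.shift_injective {K : Region d} {k : ℕ} (a : Fin d → ℤ) :
    Function.Injective (KCell.shift (K := K) (k := k) a) :=
  fun x y hxy => Subtype.ext (Cell.shift_injective a
    (show x.1.shift a = y.1.shift a from congrArg (fun c => c.1) hxy))

section Lie
variable {𝔤 : Type*} [NormedAddCommGroup 𝔤] [InnerProductSpace ℝ 𝔤]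

theorem norm_exactLieRes_le (K K' : Region d) (h : K ≤ K') (v : exactLie 𝔤 K') :
    ‖exactLieRes 𝔤 K K' h v‖ ≤ ‖v‖ :=
  norm_toLp_comp_le (KCell.incl_injective h) v.1

/-- The pullback of exact Lie algebra valued 2-cochains by a translation. -/
def exactLieShift (𝔤 : Type*) [NormedAddCommGroup 𝔤] [InnerProductSpace ℝ 𝔤] (a : Fin d → ℤ)
    (K : Region d) : exactLie 𝔤 (K.shift a) →ₗ[ℝ] exactLie 𝔤 K where
  toFun v := ⟨WithLp.toLp 2 fun c => v.1 (c.shift a), by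
    obtain ⟨_, f, rfl⟩ := v
    refine ⟨fun c => f (c.shift a), ?_⟩
    ext c
    refine Finset.sum_congr rfl fun i _ => ?_
    have h1 : (c.upper i).shift a = (c.shift a).upper i :=
      Subtype.ext (Cell.shift_upper a c.1 i)
    change _ • (f ((c.upper i).shift a) - _) = _
    rw [h1]
    rfl⟩
  map_add' _ _ := rfl
  map_smul' _ _ := rfl

theorem norm_exactLieShift_le (a : Fin d → ℤ) (K : Region d) (v : exactLie 𝔤 (K.shift a)) :
    ‖exactLieShift 𝔤 a K v‖ ≤ ‖v‖ :=
  norm_toLp_comp_le (KCell.shift_injective a) v.1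

/-- The pullback by a translation of an element of the limit of the spaces of exact Lie algebra
valued 2-cochains. -/
def lieTranslateFun (a : Fin d → ℤ) (h : exactLieLim d 𝔤) : exactLieLim d 𝔤 :=
  ⟨⟨fun K => exactLieShift 𝔤 a K (h.1 (K.shift a)), memℓp_infty_iff.2 ⟨‖h.1‖, by
      rintro _ ⟨K, rfl⟩
      exact (norm_exactLieShift_le a K _).trans
        (lp.norm_apply_le_norm ENNReal.top_ne_zero h.1 _)⟩⟩,
    fun K K' hK => by
      change exactLieRes 𝔤 K K' hK (exactLieShift 𝔤 a K' (h.1 (K'.shift a))) =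
        exactLieShift 𝔤 a K (h.1 (K.shift a))
      rw [← h.2 _ _ (Region.shift_mono a hK)]
      rfl⟩

theorem lieTranslateFun_apply (a : Fin d → ℤ) (h : exactLieLim d 𝔤) (K : Region d) :
    (lieTranslateFun a h).1 K = exactLieShift 𝔤 a K (h.1 (K.shift a)) := rfl

theorem norm_lieTranslateFun_le (a : Fin d → ℤ) (h : exactLieLim d 𝔤) :
    ‖lieTranslateFun a h‖ ≤ ‖h‖ := by
  change ‖(lieTranslateFun a h).1‖ ≤ ‖h.1‖
  refine lp.norm_le_of_forall_le (norm_nonneg h.1) fun K => ?_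
  rw [lieTranslateFun_apply]
  exact (norm_exactLieShift_le a K _).trans (lp.norm_apply_le_norm ENNReal.top_ne_zero h.1 _)

theorem lieTranslateFun_add (a : Fin d → ℤ) (h k : exactLieLim d 𝔤) :
    lieTranslateFun a (h + k) = lieTranslateFun a h + lieTranslateFun a k :=
  Subtype.ext (lp.ext (funext fun K =>
    map_add (exactLieShift 𝔤 a K) (h.1 (K.shift a)) (k.1 (K.shift a))))

theorem lieTranslateFun_smul (a : Fin d → ℤ) (c : ℝ) (h : exactLieLim d 𝔤) :
    lieTranslateFun a (c • h) = c • lieTranslateFun a h :=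
  Subtype.ext (lp.ext (funext fun K => map_smul (exactLieShift 𝔤 a K) c (h.1 (K.shift a))))

/-- The pullback by a translation on the limit of the spaces of exact Lie algebra valued
2-cochains. -/
noncomputable def lieTranslate (𝔤 : Type*) [NormedAddCommGroup 𝔤] [InnerProductSpace ℝ 𝔤]
    (a : Fin d → ℤ) : exactLieLim d 𝔤 →L[ℝ] exactLieLim d 𝔤 :=
  let T : exactLieLim d 𝔤 →ₗ[ℝ] exactLieLim d 𝔤 :=
    { toFun := lieTranslateFun a
      map_add' := lieTranslateFun_add a
      map_smul' := lieTranslateFun_smul a }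
  LinearMap.mkContinuous T 1 (fun h => (norm_lieTranslateFun_le a h).trans_eq (one_mul ‖h‖).symm)

end Lie

section Group
variable {G : Type*} [CommGroup G]

/-- The pullback of exact 2-cochains by a translation. -/
def exactShift (G : Type*) [CommGroup G] (a : Fin d → ℤ) (K : Region d) :
    exactG G (K.shift a) →* exactG G K :=
  ((relabelG G K a 2).comp (exactG G (K.shift a)).subtype).codRestrict (exactG G K) (by
    rintro ⟨_, f, rfl⟩
    exact ⟨relabelG G K a 1 f, cobG_relabelG G K a 1 f⟩)

/-- The pullback by a translation on the limit of the groups of exact 2-cochains. -/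
def exactTranslate (G : Type*) [CommGroup G] (a : Fin d → ℤ) : exactLim d G →* exactLim d G where
  toFun x := ⟨fun K => exactShift G a K (x.1 (K.shift a)), fun K K' h => by
    change exactRes G K K' h (exactShift G a K' (x.1 (K'.shift a))) =
      exactShift G a K (x.1 (K.shift a))
    rw [← x.2 _ _ (Region.shift_mono a h)]
    rfl⟩
  map_one' := rfl
  map_mul' _ _ := rfl

/-- The sign is due to conventions: `translate` pushes a cochain forward by `a`, while
`exactTranslate` pulls back. -/
theorem exactTranslate_cobLim (a : Fin d → ℤ) (x : gaugeLim d G) :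
    exactTranslate G (-a) (cobLim d G x) = cobLim d G (translate G a x) := by
  refine Subtype.ext (funext fun K => ?_)
  change exactShift G (-a) K (cobBar G _ (x.1 (K.shift (-a)))) =
    cobBar G K (gaugeShift G a K (x.1 (K.shift (-a))))
  induction x.1 (K.shift (-a)) using QuotientGroup.induction_on with
  | H f => exact Subtype.ext (cobG_relabelG G K (-a) 1 f).symm

/-- Shifting a region by `a` and back gives the same cells but not literally the same index, so the
two components are compared through the compatibility of the family. -/
theorem exactTranslate_neg (a : Fin d → ℤ) (x : exactLim d G) :
    exactTranslate G a (exactTranslate G (-a) x) = x := by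
  refine Subtype.ext (funext fun K => Subtype.ext (funext fun c => ?_))
  have hc : ∀ c : Cell d, (c.shift a).shift (-a) = c := fun c => by simp [Cell.shift]
  have hK : K ≤ (K.shift a).shift (-a) := fun c h => by
    rw [← hc c]
    exact shift_mem_shiftCells (-a) (shift_mem_shiftCells a h)
  rw [← x.2 K _ hK]
  change (x.1 ((K.shift a).shift (-a))).1 ((c.shift a).shift (-a)) =
    (x.1 ((K.shift a).shift (-a))).1 (c.incl hK)
  have h : (c.shift a).shift (-a) = c.incl hK := Subtype.ext (hc c.1)
  rw [h]

theorem continuous_exactTranslate [TopologicalSpace G] (a : Fin d → ℤ) :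
    Continuous (exactTranslate (d := d) G a) := by
  refine (continuous_pi fun K => Continuous.subtype_mk (continuous_pi fun c => ?_) _).subtype_mk _
  change Continuous fun x : exactLim d G => (x.1 (K.shift a)).1 (c.shift a)
  exact (continuous_apply (c.shift a)).comp (continuous_subtype_val.comp
    ((continuous_apply (K.shift a)).comp continuous_subtype_val))

end Group

/-! ### Invariance of the heat kernel and Villain measures -/

variable {E : Type*} [NormedAddCommGroup E] [NormedSpace ℝ E] [FiniteDimensional ℝ E]
  {G : Type*} [CommGroup G] [TopologicalSpace G] [ChartedSpace E G] [LieGroup 𝓘(ℝ, E) ∞ G]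
  [T2Space G] [CompactSpace G] {𝔤 : Type*} [NormedAddCommGroup 𝔤] [InnerProductSpace ℝ 𝔤]
  (φ : 𝔤 ≃ₗ[ℝ] GroupLieAlgebra 𝓘(ℝ, E) G)

/-- The composition of a character with a translation. -/
noncomputable def characterTranslate {G : Type*} [CommGroup G] [TopologicalSpace G] (a : Fin d → ℤ)
    (χ : PontryaginDual (exactLim d G)) : PontryaginDual (exactLim d G) :=
  ⟨(χ : exactLim d G →* Circle).comp (exactTranslate G a),
    (map_continuous χ).comp (continuous_exactTranslate a)⟩

theorem characterTranslate_neg {G : Type*} [CommGroup G] [TopologicalSpace G] (a : Fin d → ℤ)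
    (χ : PontryaginDual (exactLim d G)) :
    characterTranslate (-a) (characterTranslate a χ) = χ :=
  PontryaginDual.ext fun x => congrArg χ (exactTranslate_neg a x)

/-- The exponential map intertwines the two translations, and the exponential identity determines
the functional. -/
theorem dualVectorLim_characterTranslate (a : Fin d → ℤ) (χ : PontryaginDual (exactLim d G)) :
    dualVectorLim d φ (characterTranslate a χ) = (dualVectorLim d φ χ).comp (lieTranslate 𝔤 a) :=
  eq_dualVectorLim φ fun x => apply_limExp φ χ (lieTranslate 𝔤 a x)

/-- One inequality is contraction by `a`; the other is the same inequality for `-a`, which undoes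
the translation. -/
theorem norm_dualVectorLim_characterTranslate (a : Fin d → ℤ)
    (χ : PontryaginDual (exactLim d G)) :
    ‖dualVectorLim d φ (characterTranslate a χ)‖ = ‖dualVectorLim d φ χ‖ := by
  have key : ∀ (a : Fin d → ℤ) (χ : PontryaginDual (exactLim d G)),
      ‖dualVectorLim d φ (characterTranslate a χ)‖ ≤ ‖dualVectorLim d φ χ‖ := fun a χ => by
    rw [dualVectorLim_characterTranslate]
    exact norm_comp_le_of_forall_norm_le (norm_lieTranslateFun_le a) _
  refine le_antisymm (key a χ) ?_
  conv_lhs => rw [← characterTranslate_neg a χ]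
  exact key (-a) _

include φ in
-- Two distinct elements differ in `G` at some 2-cell of some region; a character of `G` separating
-- them there pulls back along that evaluation.
theorem exists_character_exactLim_ne [ConnectedSpace G] {x y : exactLim d G} (h : x ≠ y) :
    ∃ χ : PontryaginDual (exactLim d G), χ x ≠ χ y := by
  obtain ⟨K, c, hc⟩ : ∃ (K : Region d) (c : KCell K 2), (x.1 K).1 c ≠ (y.1 K).1 c := by
    by_contra! h'
    exact h (Subtype.ext (funext fun K => Subtype.ext (funext (h' K))))
  obtain ⟨χ, hχ, hne⟩ := exists_character_ne_one φ (g := (x.1 K).1 c / (y.1 K).1 c)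
    (div_ne_one.2 hc)
  let π : exactLim d G →* G :=
    { toFun := fun x => (x.1 K).1 c, map_one' := rfl, map_mul' := fun _ _ => rfl }
  have hπ : Continuous π := (continuous_apply c).comp (continuous_subtype_val.comp
    ((continuous_apply K).comp continuous_subtype_val))
  refine ⟨⟨χ.comp π, hχ.comp hπ⟩, fun he => hne ?_⟩
  rw [map_div, div_eq_one]
  exact he

theorem polishSpace_exactLim {G : Type*} [CommGroup G] [TopologicalSpace G]
    [IsTopologicalGroup G] [T2Space G] [CompactSpace G] [SecondCountableTopology G] :
    PolishSpace (exactLim d G) := by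
  have : ∀ K : Region d, SecondCountableTopology (exactG G K) := fun K =>
    Topology.IsInducing.subtypeVal.secondCountableTopology
  have : SecondCountableTopology (exactLim d G) :=
    Topology.IsInducing.subtypeVal.secondCountableTopology
  exact polishSpace_of_compactSpace _

theorem existsUnique_isHeatKernelMeasure [ConnectedSpace G] {β : ℝ} (hβ : 0 ≤ β) :
    ∃! μ : Measure (exactLim d G),
      IsHeatKernelMeasure (V := exactLieLim d 𝔤) (dualVectorLim d φ) β μ := by
  have := topologicalGroup_of_lieGroup 𝓘(ℝ, E) ∞ (G := G)
  have : SecondCountableTopology G := ChartedSpace.secondCountable_of_sigmaCompact E G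
  have := polishSpace_exactLim (d := d) (G := G)
  obtain ⟨μ, hμ⟩ := exists_isHeatKernelMeasure (A := exactLim d G) (H := exactLieLim d 𝔤)
    (parallelogram_projLimHilb (Φ := exactLieRes 𝔤) norm_exactLieRes_le)
    (e := limExp φ) (continuous_limExp φ) (J := dualVectorLim d φ) (apply_limExp φ) hβ
  refine ⟨μ, hμ, fun ν hν => ?_⟩
  have := hμ.1
  have := hν.1
  exact measure_ext_of_characters (A := exactLim d G)
    (fun x y hxy => exists_character_exactLim_ne (d := d) φ hxy) fun χ => (hν.2 χ).trans (hμ.2 χ).symm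

/-- The Fourier coefficient of the pushforward at `χ` is that of `μ` at the translated character,
whose dual vector has the same norm; uniqueness concludes. -/
theorem measurePreserving_exactTranslate [ConnectedSpace G] {β : ℝ} (hβ : 0 ≤ β)
    (a : Fin d → ℤ) {μ : Measure (exactLim d G)}
    (hμ : IsHeatKernelMeasure (V := exactLieLim d 𝔤) (dualVectorLim d φ) β μ) :
    MeasurePreserving (exactTranslate G a) μ μ := by
  have hm : Measurable (exactTranslate (d := d) G a) := (continuous_exactTranslate a).measurable
  refine ⟨hm, (existsUnique_isHeatKernelMeasure φ hβ).unique ?_ hμ⟩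
  have := hμ.1
  refine ⟨Measure.isProbabilityMeasure_map hm.aemeasurable, fun χ => ?_⟩
  rw [integral_map hm.aemeasurable (by
    exact (Complex.continuous_conj.comp
      (continuous_subtype_val.comp (map_continuous χ))).measurable.aestronglyMeasurable),
    ← norm_dualVectorLim_characterTranslate φ a χ]
  exact hμ.2 (characterTranslate a χ)

theorem measurePreserving_translate [ConnectedSpace G] {β : ℝ} (hβ : 0 ≤ β) (a : Fin d → ℤ) :
    MeasurePreserving (translate G a) (villainMeasure d φ β) (villainMeasure d φ β) := by
  have := topologicalGroup_of_lieGroup 𝓘(ℝ, E) ∞ (G := G)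
  have hex := (existsUnique_isHeatKernelMeasure (d := d) φ hβ).exists
  have hμ : IsHeatKernelMeasure (V := exactLieLim d 𝔤) (dualVectorLim d φ) β
      (limitHeatKernelMeasure d φ β) := by
    rw [limitHeatKernelMeasure, heatKernelMeasure, dif_pos hex]
    exact hex.choose_spec
  let e := (isHomeomorph_cobLim (d := d) (G := G)).homeomorph
  have he : Function.invFun (cobLim d G) = e.symm := by
    ext1 x
    refine e.injective ?_
    rw [e.apply_symm_apply]
    exact Function.invFun_eq (cobLim_bijective.surjective x)
  -- Under the homeomorphism `e`, translation of gauge classes is conjugate to translation of exact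
  -- 2-cochains.
  have htr : translate G a = fun x => e.symm (exactTranslate G (-a) (e x)) := by
    ext1 x
    refine e.injective ?_
    rw [e.apply_symm_apply]
    exact (exactTranslate_cobLim a x).symm
  have hme : MeasurePreserving e.symm (limitHeatKernelMeasure d φ β) (villainMeasure d φ β) :=
    ⟨e.symm.measurable, by rw [villainMeasure, he]⟩
  have hme' : MeasurePreserving e (villainMeasure d φ β) (limitHeatKernelMeasure d φ β) :=
    hme.symm e.symm.toMeasurableEquiv
  rw [htr]
  exact hme.comp ((measurePreserving_exactTranslate φ hβ (-a) hμ).comp hme')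

end Translation

end Villain

theorem mainTheorem4
    (d : ℕ) [NeZero d] (hd : 2 ≤ d)
    {E : Type*} [NormedAddCommGroup E] [NormedSpace ℝ E] [FiniteDimensional ℝ E]
    {G : Type*} [CommGroup G] [TopologicalSpace G] [T2Space G] [ChartedSpace E G]
    [LieGroup 𝓘(ℝ, E) ∞ G] [CompactSpace G] [ConnectedSpace G]
    {𝔤 : Type*} [NormedAddCommGroup 𝔤] [InnerProductSpace ℝ 𝔤]
    (φ : 𝔤 ≃ₗ[ℝ] GroupLieAlgebra 𝓘(ℝ, E) G)
    (β : ℝ) (hβ : 0 < β) :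
    (∃! μ : Measure (Villain.exactLim d G),
        Villain.IsHeatKernelMeasure (V := Villain.exactLieLim d 𝔤)
          (Villain.dualVectorLim d φ) β μ) ∧
      IsHomeomorph (Villain.cobLim d G) ∧
      ∀ a : Fin d → ℤ, MeasurePreserving (Villain.translate G a)
        (Villain.villainMeasure d φ β) (Villain.villainMeasure d φ β) := by
  have := topologicalGroup_of_lieGroup 𝓘(ℝ, E) ∞ (G := G)
  exact ⟨Villain.existsUnique_isHeatKernelMeasure φ hβ.le, Villain.isHomeomorph_cobLim,
    Villain.measurePreserving_translate φ hβ.le⟩
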